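/- Let $(R,\mathfrak m)$ be a commutative Noetherian local ring, $\mathcal S$ a Serre class of $R$-modules (a class of modules containing $0$ such that in every short exact sequence the middle term lies in $\mathcal S$ if and only if both outer terms do), and $M$ a finitely generated $R$-module. Notation. For an $R$-module $L$ put $\mathcal S\text{-}\operatorname{Supp}L=\{\mathfrak p\in\operatorname{Supp}L : R/\mathfrak p\notin\mathcal S\}$ and $\mathcal S\text{-}\operatorname{Ass}L=\{\mathfrak p\in\operatorname{Ass}L : R/\mathfrak p\notin\mathcal S\}$. Write $\operatorname{ht}_M(\mathfrak p)=\dim M_{\mathfrak p}$ for $\mathfrak p\in\operatorname{Spec}R$, and for an ideal $\mathfrak a$ of $R$ $$\mathcal S\text{-}\operatorname{ht}_M(\mathfrak a)=\inf\{\operatorname{ht}_M(\mathfrak q) : \mathfrak q\in\mathcal S\text{-}\operatorname{Supp}M,\ \mathfrak q\supseteq\mathfrak a\},\qquad \mathcal S\text{-}E.\operatorname{grade}(\mathfrak a,M)=\inf\{i\ge 0 : \operatorname{Ext}^i_R(R/\mathfrak a,M)\notin\mathcal S\},$$ where $\inf\emptyset=+\infty$. A sequence $x_1,\dots,x_r$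 in $R$ is a weak $M$-sequence with respect to $\mathcal S$ if $((x_1,\dots,x_{i-1})M:_M x_i)/(x_1,\dots,x_{i-1})M\in\mathcal S$ for all $1\le i\le r$. A system of parameters of $M$ is a sequence of $d=\dim M$ elements $x_1,\dots,x_d$ of $\mathfrak m$ such that $M/(x_1,\dots,x_d)M$ has finite length. $M$ is $\mathcal S$-Cohen–Macaulay if every system of parameters of $M$ is a weak $M$-sequence with respect to $\mathcal S$. Theorem 3.5. The following are equivalent: (i) $M$ is $\mathcal S$-Cohen–Macaulay. (ii) For every $\mathfrak p\in\mathcal S\text{-}\operatorname{Supp}M$, $M_{\mathfrak p}$ is a Cohen–Macaulay $R_{\mathfrak p}$-module and $\operatorname{ht}_M(\mathfrak p)+\dim R/\mathfrak p=\dim M$. (iii) For every $\mathfrak p\in\mathcal S\text{-}\operatorname{Supp}M$, $\mathcal S\text{-}E.\operatorname{grade}(\mathfrak p,M)=\mathcal S\text{-}\operatorname{ht}_M(\mathfrak p)=\operatorname{ht}_M(\mathfrak p)$ and $\operatorname{ht}_M(\mathfrak p)+\dim R/\mathfrak p=\dim M$. (iv) For every $\mathfrak p\in\mathcal S\text{-}\operatorname{Supp}M$,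 $\operatorname{depth}_{R_{\mathfrak p}}M_{\mathfrak p}=\dim M-\dim R/\mathfrak p$. (v) For every system of parameters $x_1,\dots,x_d$ of $M$ (where $d=\dim M$), every $0\le i\le d$ and every $\mathfrak p\in\mathcal S\text{-}\operatorname{Ass}(M/(x_1,\dots,x_i)M)$, $\dim R/\mathfrak p=\dim M-i$. (vi) $\operatorname{ht}(\mathfrak p/\mathfrak q)+\operatorname{ht}_M(\mathfrak q)=\operatorname{ht}_M(\mathfrak p)$ for all $\mathfrak q\subseteq\mathfrak p$ in $\mathcal S\text{-}\operatorname{Supp}M\cup\{\mathfrak m\}$; $M_{\mathfrak p}$ is Cohen–Macaulay for every $\mathfrak p\in\mathcal S\text{-}\operatorname{Supp}M$; and $\dim R/\mathfrak p=\dim M$ for every minimal element $\mathfrak p$ of $\mathcal S\text{-}\operatorname{Supp}M$ with respect to inclusion. -/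

import Mathlib

universe u

namespace SerreCM

open CategoryTheory

/-- The submodule `(x₁, …, xₙ) M` of `M` generated by a finite sequence of ring elements. -/
def seqSMul {R : Type u} [CommRing R] (M : Type u) [AddCommGroup M] [Module R M]
    (xs : List R) : Submodule R M :=
  Ideal.ofList xs • (⊤ : Submodule R M)

/-- The colon submodule `N :_M x = {m ∈ M | x m ∈ N}`. -/
def colon {R : Type u} [CommRing R] {M : Type u} [AddCommGroup M] [Module R M]
    (N : Submodule R M) (x : R) : Submodule R M :=
  N.comap (LinearMap.lsmul R M x)

/-- `xs = x₁, …, xᵣ` is a weak `M`-sequence with respect to `S`: for each `i` the module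
`((x₁, …, xᵢ₋₁)M :_M xᵢ) / (x₁, …, xᵢ₋₁)M` belongs to `S`. (Indices of lists start at `0`;
`N.submoduleOf P` is `N ∩ P` regarded as a submodule of `P`, here `N ≤ P`.) -/
def IsWeakSeq {R : Type u} [CommRing R] (S : ObjectProperty (ModuleCat.{u} R))
    (M : Type u) [AddCommGroup M] [Module R M] (xs : List R) : Prop :=
  ∀ (i : ℕ) (hi : i < xs.length),
    S (ModuleCat.of R
      (colon (seqSMul M (xs.take i)) xs[i] ⧸
        (seqSMul M (xs.take i)).submoduleOf (colon (seqSMul M (xs.take i)) xs[i])))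

/-- `S-Supp L`: the primes `p` in the support of `L` with `R/p` not in `S`. -/
def sSupp {R : Type u} [CommRing R] (S : ObjectProperty (ModuleCat.{u} R))
    (L : Type u) [AddCommGroup L] [Module R L] : Set (PrimeSpectrum R) :=
  {p | p ∈ Module.support R L ∧ ¬ S (ModuleCat.of R (R ⧸ p.asIdeal))}

/-- `S-Ass L`: the associated primes `p` of `L` with `R/p` not in `S`. -/
def sAss {R : Type u} [CommRing R] (S : ObjectProperty (ModuleCat.{u} R))
    (L : Type u) [AddCommGroup L] [Module R L] : Set (PrimeSpectrum R) :=
  {p | p.asIdeal ∈ associatedPrimes R L ∧ ¬ S (ModuleCat.of R (R ⧸ p.asIdeal))}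

/-- A system of parameters of a module `M` over a local ring: `d = dim M` elements of the
maximal ideal such that `M / (x₁, …, x_d) M` has finite length. -/
def IsSystemOfParameters {R : Type u} [CommRing R] [IsLocalRing R]
    (M : Type u) [AddCommGroup M] [Module R M] (xs : List R) : Prop :=
  (xs.length : WithBot ℕ∞) = Module.supportDim R M ∧
    (∀ x ∈ xs, x ∈ IsLocalRing.maximalIdeal R) ∧
    IsFiniteLength R (M ⧸ seqSMul M xs)

/-- `M` is `S`-Cohen–Macaulay: every system of parameters of `M` is a weak `M`-sequence with
respect to `S`. -/
def IsSCohenMacaulay {R : Type u} [CommRing R] [IsLocalRing R]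
    (S : ObjectProperty (ModuleCat.{u} R))
    (M : Type u) [AddCommGroup M] [Module R M] : Prop :=
  ∀ xs : List R, IsSystemOfParameters M xs → IsWeakSeq S M xs

/-- The depth of a module over a local ring: the supremum of the lengths of the `M`-regular
sequences in the maximal ideal. -/
noncomputable def depth (R : Type u) [CommRing R] [IsLocalRing R]
    (M : Type u) [AddCommGroup M] [Module R M] : ℕ∞ :=
  ⨆ (xs : List R) (_ : ∀ x ∈ xs, x ∈ IsLocalRing.maximalIdeal R)
    (_ : RingTheory.Sequence.IsRegular M xs), (xs.length : ℕ∞)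

/-- A module over a local ring is Cohen–Macaulay if it is zero or its depth equals its
dimension. (Meant for finitely generated modules over Noetherian local rings.) -/
def IsCohenMacaulay (R : Type u) [CommRing R] [IsLocalRing R]
    (M : Type u) [AddCommGroup M] [Module R M] : Prop :=
  Subsingleton M ∨ (depth R M : WithBot ℕ∞) = Module.supportDim R M

/-- The localization `M_p` of a module at a prime, a module over `R_p`. -/
abbrev localizedAt {R : Type u} [CommRing R] (M : Type u) [AddCommGroup M] [Module R M]
    (p : PrimeSpectrum R) : Type u :=
  LocalizedModule p.asIdeal.primeCompl M

/-- `ht_M(p) = dim M_p`, the height of the prime `p` on `M`. -/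
noncomputable def ht {R : Type u} [CommRing R] (M : Type u) [AddCommGroup M] [Module R M]
    (p : PrimeSpectrum R) : WithBot ℕ∞ :=
  Module.supportDim (Localization.AtPrime p.asIdeal) (localizedAt M p)

/-- `S-ht_M(a)`: the infimum of `ht_M(q)` over the primes `q ⊇ a` in `S-Supp M`. -/
noncomputable def sHt {R : Type u} [CommRing R] (S : ObjectProperty (ModuleCat.{u} R))
    (M : Type u) [AddCommGroup M] [Module R M] (a : Ideal R) : WithBot ℕ∞ :=
  ⨅ q ∈ sSupp S M ∩ PrimeSpectrum.zeroLocus (a : Set R), ht M q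

/-- `S-E.grade(a, M)`: the infimum of the `i ≥ 0` such that the `R`-module `Extⁱ(R/a, M)` is
not in `S` (infinite if there is no such `i`). -/
noncomputable def sExtGrade {R : Type u} [CommRing R] (S : ObjectProperty (ModuleCat.{u} R))
    (a : Ideal R) (M : Type u) [AddCommGroup M] [Module R M] : ℕ∞ :=
  ⨅ (i : ℕ) (_ : ¬ S (ModuleCat.of R
    (Abelian.Ext (ModuleCat.of R (R ⧸ a)) (ModuleCat.of R M) i))), (i : ℕ∞)

/-- The height of `p/q`, an ideal of the ring `R/q`. -/
noncomputable def htQuot {R : Type u} [CommRing R] (p q : PrimeSpectrum R) : ℕ∞ :=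
  (p.asIdeal.map (Ideal.Quotient.mk q.asIdeal)).height

end SerreCM

/-!
A finitely generated module `N` over a Noetherian ring lies in a Serre class `S` iff `R/q ∈ S` for
every `q ∈ Ass N`, equivalently for every `q ∈ Supp N` (`prop_iff_associatedPrimes`,
`prop_iff_support`). So everything is governed by the set `P` of the primes `p` with `R/p ∉ S`,
which is closed under passing to smaller primes: `x₁, …, xᵣ` is a weak `M`-sequence with respect to
`S` iff no `xᵢ` lies in a member of `P ∩ Ass (M / (x₁, …, xᵢ₋₁) M)` (`isWeakSeq_iff`), and it then
becomes weakly regular on `M_p` for each `p ∈ P` (`IsWeakSeq.isWeaklyRegular`). What remains is the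
theory of Cohen–Macaulay modules, localized at the primes of `P`.

The cycle (i) ⇒ (iii) ⇒ (iv) ⇒ (ii) ⇒ (v) ⇒ (i) goes as follows.

* (i) ⇒ (iii): by prime avoidance `p` contains part of a system of parameters, of length
  `dim M - dim R/p` (`exists_isParamSeq`). It is a weak sequence by (i), hence regular on `M_p`, and
  `dim M - dim R/p ≤ depth M_p ≤ dim M_p ≤ dim M - dim R/p`. A version of Rees' theorem modulo `S`
  (`forall_prop_ext_iff_exists_isWeakSeq`) turns lengths of weak sequences in `p` into the `Ext`
  grade of `p`.
* (iii) ⇒ (iv) is Rees' theorem again: the `Ext` grade is at most `depth M_p`. (iv) ⇒ (ii) follows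
  from `depth M_p ≤ dim M_p ≤ dim M - dim R/p`.
* (ii) ⇒ (v): for `p ∈ Ass (M / (x₁, …, xᵢ) M)` the elements `x₁, …, xᵢ` form part of a system of
  parameters of the Cohen–Macaulay module `M_p`, so they are regular on it; the quotient has depth
  zero, which forces `i = dim M_p` (`length_eq_ht_of_mem_associatedPrimes`).
* (v) ⇒ (i): if `xᵢ₊₁` belonged to some `q ∈ P ∩ Ass (M / (x₁, …, xᵢ) M)`, then
  `dim R/q ≤ dim M - i - 1` (`isSCohenMacaulay_of_dim_quotient`).

For (ii) ⇒ (vi) the dimension formula inside a Cohen–Macaulay `M_p` is (i) ⇒ (ii) over `R_p` for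
the Serre class of zero modules (`htQuot_add_ht_of_isCohenMacaulay`). For (vi) ⇒ (ii) it suffices to
apply the height formula to the pair `p ⊆ 𝔪`.
-/

namespace SerreCM

open CategoryTheory

/-! ### Serre classes and finitely generated modules -/

section SerreClass

variable {R : Type u} [CommRing R] (S : ObjectProperty (ModuleCat.{u} R)) [S.IsSerreClass]

variable {A B C : Type u} [AddCommGroup A] [Module R A] [AddCommGroup B] [Module R B]
  [AddCommGroup C] [Module R C]

theorem prop_of_injective (f : A →ₗ[R] B) (hf : Function.Injective f)
    (h : S (ModuleCat.of R B)) : S (ModuleCat.of R A) := by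
  have : Mono (ModuleCat.ofHom f) := (ModuleCat.mono_iff_injective _).mpr hf
  exact S.prop_of_mono (ModuleCat.ofHom f) h

theorem prop_of_surjective (f : A →ₗ[R] B) (hf : Function.Surjective f)
    (h : S (ModuleCat.of R A)) : S (ModuleCat.of R B) := by
  have : Epi (ModuleCat.ofHom f) := (ModuleCat.epi_iff_surjective _).mpr hf
  exact S.prop_of_epi (ModuleCat.ofHom f) h

theorem prop_of_subsingleton [Subsingleton A] : S (ModuleCat.of R A) :=
  S.prop_of_isZero (ModuleCat.isZero_of_subsingleton _)

theorem prop_of_exact (f : A →ₗ[R] B) (g : B →ₗ[R] C) (h : Function.Exact f g)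
    (hA : S (ModuleCat.of R A)) (hC : S (ModuleCat.of R C)) : S (ModuleCat.of R B) := by
  let T : ShortComplex (ModuleCat.{u} R) :=
    ShortComplex.mk (ModuleCat.ofHom f) (ModuleCat.ofHom g) (by
      ext x; exact h.apply_apply_eq_zero x)
  have hT : T.Exact := (ShortComplex.ShortExact.moduleCat_exact_iff_function_exact T).mpr h
  exact S.prop_X₂_of_exact hT hA hC

/-- If `R/q` lies outside the Serre class for some `q ⊇ p`, then so does `R/p`. -/
theorem prop_quotient_of_le {p q : Ideal R} (hpq : p ≤ q) (h : S (ModuleCat.of R (R ⧸ p))) :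
    S (ModuleCat.of R (R ⧸ q)) :=
  prop_of_surjective S (Ideal.Quotient.factorₐ R hpq).toLinearMap
    (Ideal.Quotient.factor_surjective hpq) h

theorem prop_of_support [IsNoetherianRing R] {N : Type u} [AddCommGroup N] [Module R N]
    [hN : Module.Finite R N]
    (h : ∀ p ∈ Module.support R N, S (ModuleCat.of R (R ⧸ p.asIdeal))) :
    S (ModuleCat.of R N) := by
  induction hN using IsNoetherianRing.induction_on_isQuotientEquivQuotientPrime R with
  | subsingleton N => exact prop_of_subsingleton S
  | quotient N p e =>
    refine prop_of_injective S e.toLinearMap e.injective (h p ?_)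
    rw [e.support_eq, Module.support_eq_zeroLocus, Ideal.annihilator_quotient]
    exact fun _ hx => hx
  | exact N₁ N₂ N₃ f g hf hg hfg h₁ h₃ =>
    refine prop_of_exact S f g hfg (h₁ fun p hp => h p ?_) (h₃ fun p hp => h p ?_)
    · exact Module.support_subset_of_injective f hf hp
    · exact Module.support_subset_of_surjective g hg hp

theorem exists_associatedPrime_le [IsNoetherianRing R] {N : Type u} [AddCommGroup N] [Module R N]
    [Module.Finite R N] {p : PrimeSpectrum R} (hp : p ∈ Module.support R N) :
    ∃ q : PrimeSpectrum R, q.asIdeal ∈ associatedPrimes R N ∧ q ≤ p ∧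
      q.asIdeal ∈ (Module.annihilator R N).minimalPrimes := by
  obtain ⟨q, hq, hqp⟩ := Ideal.exists_minimalPrimes_le (Module.mem_support_iff_of_finite.mp hp)
  exact ⟨⟨q, hq.isPrime⟩,
    Module.associatedPrimes.minimalPrimes_annihilator_subset_associatedPrimes R N hq, hqp, hq⟩

theorem mem_support_of_mem_associatedPrimes {N : Type u} [AddCommGroup N]
    [Module R N] [Module.Finite R N] {p : PrimeSpectrum R}
    (hp : p.asIdeal ∈ associatedPrimes R N) : p ∈ Module.support R N :=
  Module.mem_support_iff_of_finite.mpr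
    (Submodule.annihilator_top.ge.trans (IsAssociatedPrime.annihilator_le hp))

/-- Membership of a finitely generated module in a Serre class is decided by its associated primes:
they include the minimal primes of the support, and the module is filtered by quotients `R/p` with
`p` in the support. -/
theorem prop_iff_associatedPrimes [IsNoetherianRing R] {N : Type u} [AddCommGroup N] [Module R N]
    [Module.Finite R N] :
    S (ModuleCat.of R N) ↔ ∀ p : PrimeSpectrum R, p.asIdeal ∈ associatedPrimes R N →
      S (ModuleCat.of R (R ⧸ p.asIdeal)) := by
  refine ⟨fun h p hp => ?_, fun h => prop_of_support S fun p hp => ?_⟩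
  · obtain ⟨-, f, hf⟩ := (isAssociatedPrime_iff_exists_injective_linearMap p.asIdeal N).mp hp
    exact prop_of_injective S f hf h
  · obtain ⟨q, hq, hqp, -⟩ := exists_associatedPrime_le hp
    exact prop_quotient_of_le S hqp (h q hq)

theorem prop_iff_support [IsNoetherianRing R] {N : Type u} [AddCommGroup N] [Module R N]
    [Module.Finite R N] :
    S (ModuleCat.of R N) ↔ ∀ p ∈ Module.support R N, S (ModuleCat.of R (R ⧸ p.asIdeal)) := by
  refine ⟨fun h p hp => ?_, prop_of_support S⟩
  obtain ⟨q, hq, hqp, -⟩ := exists_associatedPrime_le hp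
  exact prop_quotient_of_le S hqp ((prop_iff_associatedPrimes S).mp h q hq)

end SerreClass

/-! ### Weak sequences and associated primes -/

section WeakSequence

variable {R : Type u} [CommRing R] [IsNoetherianRing R]
  (S : ObjectProperty (ModuleCat.{u} R)) [S.IsSerreClass]
  {M : Type u} [AddCommGroup M] [Module R M] [Module.Finite R M]

/-- A kernel of multiplication by `x` lies in the Serre class iff `x` avoids the associated primes
outside the class, as `Ass (ker x) = {q ∈ Ass M | x ∈ q}`. The kernel appears through any
injective map `j` onto it. -/
theorem prop_iff_of_range_eq_ker {K : Type u} [AddCommGroup K] [Module R K] (x : R)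
    (j : K →ₗ[R] M) (hj : Function.Injective j)
    (hr : LinearMap.range j = LinearMap.ker (LinearMap.lsmul R M x)) :
    S (ModuleCat.of R K) ↔ ∀ q ∈ sAss S M, x ∉ q.asIdeal := by
  have : Module.Finite R K := Module.Finite.of_injective j hj
  rw [prop_iff_associatedPrimes S]
  have key : ∀ q : PrimeSpectrum R, q.asIdeal ∈ associatedPrimes R K ↔
      q.asIdeal ∈ associatedPrimes R M ∧ x ∈ q.asIdeal := by
    intro q
    constructor
    · intro hq
      refine ⟨associatedPrimes.subset_of_injective hj hq, ?_⟩
      have h := IsAssociatedPrime.annihilator_le hq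
      rw [Submodule.annihilator_top] at h
      refine h (Module.mem_annihilator.mpr fun k => hj ?_)
      have : j k ∈ LinearMap.ker (LinearMap.lsmul R M x) := hr ▸ LinearMap.mem_range_self j k
      simpa using this
    · rintro ⟨hq, hx⟩
      rw [AssociatedPrimes.mem_iff, isAssociatedPrime_iff] at hq ⊢
      obtain ⟨hq, y, hy⟩ := hq
      have hxy : x • y = 0 := by
        have := hy ▸ hx
        simpa [Submodule.mem_colon_singleton] using this
      obtain ⟨k, rfl⟩ : y ∈ LinearMap.range j := by rw [hr]; simpa using hxy
      refine ⟨hq, k, ?_⟩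
      rw [hy]
      ext r
      simp only [Submodule.mem_colon_singleton, Submodule.mem_bot, ← map_smul,
        map_eq_zero_iff j hj]
  constructor
  · intro h q hq hx
    exact hq.2 (h q ((key q).mpr ⟨hq.1, hx⟩))
  · intro h q hq
    by_contra hS
    exact h q ⟨((key q).mp hq).1, hS⟩ ((key q).mp hq).2

theorem prop_ker_iff (x : R) :
    S (ModuleCat.of R (LinearMap.ker (LinearMap.lsmul R M x))) ↔
      ∀ q ∈ sAss S M, x ∉ q.asIdeal :=
  prop_iff_of_range_eq_ker S x (Submodule.subtype _) (Submodule.injective_subtype _)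
    (Submodule.range_subtype _)

theorem prop_colon_iff (N : Submodule R M) (x : R) :
    S (ModuleCat.of R (colon N x ⧸ N.submoduleOf (colon N x))) ↔
      ∀ q ∈ sAss S (M ⧸ N), x ∉ q.asIdeal := by
  refine prop_iff_of_range_eq_ker S x
    (Submodule.mapQ (N.submoduleOf (colon N x)) N (colon N x).subtype le_rfl) ?_ ?_
  · rw [← LinearMap.ker_eq_bot]
    exact Submodule.ker_liftQ_eq_bot _ _ _ (by simp [LinearMap.ker_comp, Submodule.submoduleOf])
  · ext y
    obtain ⟨y, rfl⟩ := Submodule.Quotient.mk_surjective _ y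
    simp only [LinearMap.mem_range, LinearMap.mem_ker, LinearMap.lsmul_apply]
    rw [← Submodule.Quotient.mk_smul, Submodule.Quotient.mk_eq_zero]
    constructor
    · rintro ⟨k, hk⟩
      obtain ⟨⟨k, hkx⟩, rfl⟩ := Submodule.Quotient.mk_surjective _ k
      replace hk : (Submodule.Quotient.mk k : M ⧸ N) = Submodule.Quotient.mk y := hk
      rw [Submodule.Quotient.eq] at hk
      have h1 : x • k ∈ N := hkx
      have h2 : x • (k - y) ∈ N := N.smul_mem x hk
      rw [smul_sub] at h2
      simpa using N.sub_mem h1 h2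
    · intro hy
      exact ⟨Submodule.Quotient.mk ⟨y, hy⟩, rfl⟩

theorem isWeakSeq_iff (xs : List R) :
    IsWeakSeq S M xs ↔ ∀ (i : ℕ) (hi : i < xs.length),
      ∀ q ∈ sAss S (M ⧸ seqSMul M (xs.take i)), xs[i] ∉ q.asIdeal :=
  forall₂_congr fun _ _ => prop_colon_iff S _ _

omit [IsNoetherianRing R] [Module.Finite R M] [S.IsSerreClass] in
theorem sAss_congr {M' : Type u} [AddCommGroup M'] [Module R M'] (e : M ≃ₗ[R] M') :
    sAss S M = sAss S M' := by
  ext p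
  simp only [sAss, Set.mem_ofPred_eq]
  rw [LinearEquiv.AssociatedPrimes.eq e]

theorem isWeakSeq_cons_iff (x : R) (xs : List R) :
    IsWeakSeq S M (x :: xs) ↔
      S (ModuleCat.of R (LinearMap.ker (LinearMap.lsmul R M x))) ∧
        IsWeakSeq S (QuotSMulTop x M) xs := by
  rw [isWeakSeq_iff, isWeakSeq_iff, prop_ker_iff S]
  have h0 : sAss S (M ⧸ seqSMul M ((x :: xs).take 0)) = sAss S M :=
    sAss_congr S (Submodule.quotEquivOfEqBot _ (by simp [seqSMul]))
  have h1 : ∀ i, sAss S (M ⧸ seqSMul M ((x :: xs).take (i + 1))) =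
      sAss S (QuotSMulTop x M ⧸ seqSMul (QuotSMulTop x M) (xs.take i)) := fun i =>
    sAss_congr S (Submodule.quotOfListConsSMulTopEquivQuotSMulTopInner M x (xs.take i))
  constructor
  · intro h
    refine ⟨fun q hq => h 0 (by simp) q (h0 ▸ hq), fun i hi q hq => ?_⟩
    exact h (i + 1) (by simpa using hi) q (h1 i ▸ hq)
  · rintro ⟨h, h'⟩ (_ | i) hi q hq
    · exact h q (h0 ▸ hq)
    · exact h' i (by simpa using hi) q (h1 i ▸ hq)

end WeakSequence

/-! ### Localization at a prime -/

section Localization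

variable {R : Type u} [CommRing R] {M : Type u} [AddCommGroup M] [Module R M]

/-- The quotient `M_p / I M_p` is a localization of `M / I M`. -/
theorem exists_isLocalizedModule_quotient (p : PrimeSpectrum R) (I : Ideal R) :
    ∃ f : (M ⧸ (I • ⊤ : Submodule R M)) →ₗ[R]
        (localizedAt M p ⧸ (I.map (algebraMap R (Localization.AtPrime p.asIdeal)) • ⊤ :
          Submodule (Localization.AtPrime p.asIdeal) (localizedAt M p))),
      IsLocalizedModule p.asIdeal.primeCompl f := by
  have h : (I • ⊤ : Submodule R M).localized' (Localization.AtPrime p.asIdeal)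
      p.asIdeal.primeCompl (LocalizedModule.mkLinearMap p.asIdeal.primeCompl M) =
      I.map (algebraMap R (Localization.AtPrime p.asIdeal)) • ⊤ := by
    rw [Submodule.localized'_smul, Submodule.localized'_top, Ideal.localized'_eq_map]
  rw [← h]
  exact ⟨_, IsLocalizedModule.toLocalizedQuotient' _ _ _ _⟩

variable [IsNoetherianRing R]

/-- Outside the primes `p` with `R/p ∈ S`, weak sequences with respect to `S` become weakly
regular. -/
theorem IsWeakSeq.isWeaklyRegular (S : ObjectProperty (ModuleCat.{u} R)) [S.IsSerreClass]
    [Module.Finite R M]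
    {xs : List R} (h : IsWeakSeq S M xs) (p : PrimeSpectrum R)
    (hp : ¬ S (ModuleCat.of R (R ⧸ p.asIdeal))) :
    RingTheory.Sequence.IsWeaklyRegular (localizedAt M p)
      (xs.map (algebraMap R (Localization.AtPrime p.asIdeal))) := by
  rw [isWeakSeq_iff] at h
  refine ⟨fun i hi => ?_⟩
  rw [List.length_map] at hi
  rw [List.getElem_map, ← List.map_take, ← Ideal.map_ofList]
  obtain ⟨f, hf⟩ := exists_isLocalizedModule_quotient (M := M) p (Ideal.ofList (xs.take i))
  by_contra hreg
  have hmem : algebraMap R (Localization.AtPrime p.asIdeal) xs[i] ∈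
      {r | IsSMulRegular (localizedAt M p ⧸
        ((Ideal.ofList (xs.take i)).map (algebraMap R (Localization.AtPrime p.asIdeal)) • ⊤ :
          Submodule (Localization.AtPrime p.asIdeal) (localizedAt M p))) r}ᶜ := hreg
  rw [← biUnion_associatedPrimes_eq_compl_regular] at hmem
  simp only [Set.mem_iUnion] at hmem
  obtain ⟨Q, hQ, hxQ⟩ := hmem
  rw [← Module.associatedPrimes.preimage_comap_associatedPrimes_eq_associatedPrimes_of_isLocalizedModule
    p.asIdeal.primeCompl (Localization.AtPrime p.asIdeal) f, Set.mem_preimage] at hQ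
  have hprime := IsAssociatedPrime.isPrime hQ
  refine h i hi ⟨_, hprime⟩ ⟨hQ, fun hS => hp (prop_quotient_of_le S ?_ hS)⟩ hxQ
  have hne : Q ≠ ⊤ := fun h => hprime.ne_top (by rw [h, Ideal.comap_top])
  have := IsLocalRing.le_maximalIdeal hne
  have h2 := Ideal.comap_mono (f := algebraMap R (Localization.AtPrime p.asIdeal)) this
  exact h2.trans_eq (Localization.AtPrime.under_maximalIdeal (I := p.asIdeal))

end Localization

end SerreCM

namespace SerreCM

/-! ### Dimensions as lengths of chains of primes -/

section Dimension

open Order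

variable {R : Type u} [CommRing R]

theorem ringKrullDim_quotient_eq_krullDim_Ici (p : PrimeSpectrum R) :
    ringKrullDim (R ⧸ p.asIdeal) = krullDim (Set.Ici p) := by
  rw [ringKrullDim_quotient]
  rfl

theorem ringKrullDim_quotient_eq_coheight (p : PrimeSpectrum R) :
    ringKrullDim (R ⧸ p.asIdeal) = coheight p := by
  rw [ringKrullDim_quotient_eq_krullDim_Ici, coheight_eq_krullDim_Ici]

/-- The inclusion `Spec R_p → Spec R`, which has image `{q | q ⊆ p}`. -/
noncomputable def specLocalization (p : PrimeSpectrum R) :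
    PrimeSpectrum (Localization.AtPrime p.asIdeal) ↪o PrimeSpectrum R :=
  (IsLocalization.AtPrime.primeSpectrumOrderIso (Localization.AtPrime p.asIdeal)
    p.asIdeal).toOrderEmbedding.trans (OrderEmbedding.subtype _)

theorem specLocalization_asIdeal (p : PrimeSpectrum R)
    (Q : PrimeSpectrum (Localization.AtPrime p.asIdeal)) :
    (specLocalization p Q).asIdeal = Q.asIdeal.comap (algebraMap R _) := rfl

theorem range_specLocalization (p : PrimeSpectrum R) :
    Set.range (specLocalization p) = Set.Iic p := by
  ext q
  constructor
  · rintro ⟨Q, rfl⟩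
    exact (IsLocalization.AtPrime.primeSpectrumOrderIso (Localization.AtPrime p.asIdeal)
      p.asIdeal Q).2
  · intro hq
    refine ⟨(IsLocalization.AtPrime.primeSpectrumOrderIso (Localization.AtPrime p.asIdeal)
      p.asIdeal).symm ⟨q, hq⟩, ?_⟩
    simp [specLocalization]

theorem krullDim_image {α β : Type*} [Preorder α] [Preorder β] (f : α ↪o β) (s : Set α) :
    krullDim (f '' s) = krullDim s :=
  (krullDim_eq_of_orderIso
    { toEquiv := Equiv.Set.image f s f.injective
      map_rel_iff' := f.le_iff_le }).symm

theorem krullDim_congr_set {α : Type*} [Preorder α] {s t : Set α} (h : s = t) :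
    krullDim s = krullDim t := by
  rw [h]

variable (M : Type u) [AddCommGroup M] [Module R M]

/-- `Supp M_p` over `R_p` is the part of `Supp M` below `p`. No finiteness of `M` is needed. -/
theorem mem_support_localizedAt_iff (p : PrimeSpectrum R)
    (Q : PrimeSpectrum (Localization.AtPrime p.asIdeal)) :
    Q ∈ Module.support (Localization.AtPrime p.asIdeal) (localizedAt M p) ↔
      specLocalization p Q ∈ Module.support R M := by
  have hQp : specLocalization p Q ≤ p := by
    have : specLocalization p Q ∈ Set.range (specLocalization p) := ⟨Q, rfl⟩
    rwa [range_specLocalization] at this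
  rw [← not_iff_not, Module.notMem_support_iff', Module.notMem_support_iff']
  simp only [specLocalization_asIdeal]
  constructor
  · intro h m
    obtain ⟨t, ht, htm⟩ := h (LocalizedModule.mkLinearMap p.asIdeal.primeCompl M m)
    obtain ⟨r, s, rfl⟩ := IsLocalization.exists_mk'_eq p.asIdeal.primeCompl t
    have hr : algebraMap R (Localization.AtPrime p.asIdeal) r ∉ Q.asIdeal := fun h =>
      ht ((IsLocalization.mk'_eq_mul_mk'_one (S := Localization.AtPrime p.asIdeal) r s) ▸
        Q.asIdeal.mul_mem_right _ h)
    rw [← IsLocalizedModule.mk'_one p.asIdeal.primeCompl, IsLocalizedModule.mk'_smul_mk',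
      IsLocalizedModule.mk'_eq_zero'] at htm
    obtain ⟨u, hu⟩ := htm
    refine ⟨u * r, fun hmul => ?_, by rw [mul_smul]; exact hu⟩
    rcases Q.2.mem_or_mem (by simpa using hmul) with h1 | h1
    · exact u.2 (hQp h1)
    · exact hr h1
  · intro h m
    obtain ⟨⟨m, s⟩, rfl⟩ := IsLocalizedModule.mk'_surjective p.asIdeal.primeCompl
      (LocalizedModule.mkLinearMap p.asIdeal.primeCompl M) m
    obtain ⟨r, hr, hrm⟩ := h m
    refine ⟨algebraMap R _ r, hr, ?_⟩
    rw [Function.uncurry_apply_pair, algebraMap_smul, ← IsLocalizedModule.mk'_smul, hrm,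
      IsLocalizedModule.mk'_zero]

theorem specLocalization_image_support (p : PrimeSpectrum R) :
    specLocalization p '' Module.support (Localization.AtPrime p.asIdeal) (localizedAt M p) =
      Module.support R M ∩ Set.Iic p := by
  ext q
  rw [← range_specLocalization]
  constructor
  · rintro ⟨Q, hQ, rfl⟩
    exact ⟨(mem_support_localizedAt_iff M p Q).mp hQ, Q, rfl⟩
  · rintro ⟨hq, Q, rfl⟩
    exact ⟨Q, (mem_support_localizedAt_iff M p Q).mpr hq, rfl⟩

theorem ht_eq_krullDim (p : PrimeSpectrum R) :
    ht M p = krullDim (Module.support R M ∩ Set.Iic p : Set (PrimeSpectrum R)) := by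
  rw [← specLocalization_image_support, krullDim_image]
  rfl

variable {M}

theorem ht_eq_height {p : PrimeSpectrum R} (hp : p ∈ Module.support R M) :
    ht M p = height (⟨p, hp⟩ : Module.support R M) := by
  rw [ht_eq_krullDim, height_eq_krullDim_Iic]
  rw [← krullDim_image (OrderEmbedding.subtype _) (Set.Iic (⟨p, hp⟩ : Module.support R M))]
  refine krullDim_congr_set ?_
  ext q
  simp only [Set.mem_inter_iff, Set.mem_Iic, Set.mem_image, OrderEmbedding.subtype_apply]
  constructor
  · rintro ⟨h1, h2⟩
    exact ⟨⟨q, h1⟩, h2, rfl⟩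
  · rintro ⟨⟨q, h1⟩, h2, rfl⟩
    exact ⟨h1, h2⟩

theorem ringKrullDim_quotient_eq_coheight_support {p : PrimeSpectrum R}
    (hp : p ∈ Module.support R M) :
    ringKrullDim (R ⧸ p.asIdeal) = coheight (⟨p, hp⟩ : Module.support R M) := by
  rw [ringKrullDim_quotient_eq_krullDim_Ici, coheight_eq_krullDim_Ici]
  rw [← krullDim_image (OrderEmbedding.subtype _) (Set.Ici (⟨p, hp⟩ : Module.support R M))]
  refine krullDim_congr_set ?_
  ext q
  simp only [Set.mem_Ici, Set.mem_image, OrderEmbedding.subtype_apply]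
  constructor
  · intro h2
    exact ⟨⟨q, Module.mem_support_mono h2 hp⟩, h2, rfl⟩
  · rintro ⟨⟨q, h1⟩, h2, rfl⟩
    exact h2

theorem ht_add_dim_le {p : PrimeSpectrum R} (hp : p ∈ Module.support R M) :
    ht M p + ringKrullDim (R ⧸ p.asIdeal) ≤ Module.supportDim R M := by
  have : Nonempty (Module.support R M) := ⟨⟨p, hp⟩⟩
  rw [ht_eq_height hp, ringKrullDim_quotient_eq_coheight_support hp, Module.supportDim,
    krullDim_eq_iSup_height_add_coheight_of_nonempty, ← WithBot.coe_add, WithBot.coe_le_coe]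
  exact le_iSup (fun a : Module.support R M => height a + coheight a) ⟨p, hp⟩

theorem ht_mono {p q : PrimeSpectrum R} (hqp : q ≤ p) : ht M q ≤ ht M p := by
  rw [ht_eq_krullDim, ht_eq_krullDim]
  exact krullDim_le_of_strictMono
    (Set.inclusion (Set.inter_subset_inter_right _ (Set.Iic_subset_Iic.mpr hqp)))
    fun _ _ h => h

theorem dim_quotient_anti {p q : PrimeSpectrum R} (hqp : q ≤ p) :
    ringKrullDim (R ⧸ p.asIdeal) ≤ ringKrullDim (R ⧸ q.asIdeal) := by
  rw [ringKrullDim_quotient_eq_coheight, ringKrullDim_quotient_eq_coheight, WithBot.coe_le_coe]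
  exact coheight_anti hqp

theorem dim_quotient_le_supportDim {p : PrimeSpectrum R} (hp : p ∈ Module.support R M) :
    ringKrullDim (R ⧸ p.asIdeal) ≤ Module.supportDim R M := by
  rw [ringKrullDim_quotient_eq_coheight_support hp]
  exact coheight_le_krullDim _

theorem htQuot_eq_krullDim_Icc {p q : PrimeSpectrum R} (hqp : q ≤ p) :
    (htQuot p q : WithBot ℕ∞) = krullDim (Set.Icc q p) := by
  let e := Ideal.primeSpectrumQuotientOrderIsoZeroLocus q.asIdeal
  let f : PrimeSpectrum (R ⧸ q.asIdeal) ↪o PrimeSpectrum R :=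
    e.toOrderEmbedding.trans (OrderEmbedding.subtype _)
  have hP : (p.asIdeal.map (Ideal.Quotient.mk q.asIdeal)) = (e.symm ⟨p, hqp⟩).asIdeal := rfl
  have hf : ∀ P, f P = (e P).1 := fun _ => rfl
  rw [htQuot, hP, PrimeSpectrum.height_eq_orderHeight, height_eq_krullDim_Iic, ← krullDim_image f]
  refine krullDim_congr_set ?_
  ext r
  constructor
  · rintro ⟨P, h, rfl⟩
    refine ⟨(e P).2, ?_⟩
    have := e.monotone (Set.mem_Iic.mp h)
    rwa [OrderIso.apply_symm_apply] at this
  · rintro ⟨h1, h2⟩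
    refine ⟨e.symm ⟨r, h1⟩, e.symm.monotone (by exact h2), ?_⟩
    rw [hf, OrderIso.apply_symm_apply]

theorem dim_quotient_localization {p : PrimeSpectrum R}
    (Q : PrimeSpectrum (Localization.AtPrime p.asIdeal)) :
    ringKrullDim (Localization.AtPrime p.asIdeal ⧸ Q.asIdeal) =
      krullDim (Set.Icc (specLocalization p Q) p) := by
  rw [ringKrullDim_quotient_eq_krullDim_Ici, ← krullDim_image (specLocalization p)]
  refine krullDim_congr_set ?_
  ext q
  constructor
  · rintro ⟨Q', h, rfl⟩
    exact ⟨(specLocalization p).le_iff_le.mpr h, (range_specLocalization p).le ⟨Q', rfl⟩⟩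
  · rintro ⟨h1, h2⟩
    obtain ⟨Q', rfl⟩ := (range_specLocalization p).ge h2
    exact ⟨Q', (specLocalization p).le_iff_le.mp h1, rfl⟩

theorem ht_localization {p : PrimeSpectrum R}
    (Q : PrimeSpectrum (Localization.AtPrime p.asIdeal)) :
    ht (localizedAt M p) Q = ht M (specLocalization p Q) := by
  rw [ht_eq_krullDim, ht_eq_krullDim, ← krullDim_image (specLocalization p)]
  refine krullDim_congr_set ?_
  have hQp : specLocalization p Q ≤ p := (range_specLocalization p).le ⟨Q, rfl⟩
  ext q
  constructor
  · rintro ⟨Q', ⟨h1, h2⟩, rfl⟩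
    exact ⟨(mem_support_localizedAt_iff M p Q').mp h1, (specLocalization p).le_iff_le.mpr h2⟩
  · rintro ⟨h1, h2⟩
    obtain ⟨Q', rfl⟩ := (range_specLocalization p).ge (le_trans (Set.mem_Iic.mp h2) hQp)
    exact ⟨Q', ⟨(mem_support_localizedAt_iff M p Q').mpr h1,
      (specLocalization p).le_iff_le.mp h2⟩, rfl⟩

end Dimension

end SerreCM

namespace SerreCM

/-! ### Systems of parameters -/

section Parameters

open IsLocalRing Order

variable {R : Type u} [CommRing R] [IsLocalRing R]

/-- Part of a system of parameters of `M`: elements `x₁, …, xᵣ` of the maximal ideal with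
`dim M / (x₁, …, xᵣ) M + r = dim M`. -/
def IsParamSeq (M : Type u) [AddCommGroup M] [Module R M] (xs : List R) : Prop :=
  (∀ x ∈ xs, x ∈ maximalIdeal R) ∧
    Module.supportDim R (M ⧸ seqSMul M xs) + xs.length = Module.supportDim R M

variable (M : Type u) [AddCommGroup M] [Module R M]

omit [IsLocalRing R] in
theorem supportDim_quotient_nil :
    Module.supportDim R (M ⧸ seqSMul M ([] : List R)) = Module.supportDim R M :=
  Module.supportDim_eq_of_equiv (Submodule.quotEquivOfEqBot _ (by simp [seqSMul]))

omit [IsLocalRing R] in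
theorem supportDim_quotient_cons (x : R) (xs : List R) :
    Module.supportDim R (M ⧸ seqSMul M (x :: xs)) =
      Module.supportDim R (QuotSMulTop x M ⧸ seqSMul (QuotSMulTop x M) xs) :=
  Module.supportDim_eq_of_equiv (Submodule.quotOfListConsSMulTopEquivQuotSMulTopInner M x xs)

theorem isParamSeq_nil : IsParamSeq M ([] : List R) :=
  ⟨by simp, by simp [supportDim_quotient_nil]⟩

variable [IsNoetherianRing R] [Module.Finite R M]

omit [Module.Finite R M] in
theorem exists_supportDim_eq [Nontrivial M] : ∃ n : ℕ, Module.supportDim R M = n := by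
  have h1 : Module.supportDim R M ≠ ⊥ := Module.supportDim_ne_bot_of_nontrivial R M
  have h2 : Module.supportDim R M ≠ ⊤ := fun h =>
    ringKrullDim_ne_top (R := R) (top_le_iff.mp (h ▸ Module.supportDim_le_ringKrullDim R M))
  obtain ⟨n, hn⟩ := WithBot.ne_bot_iff_exists.mp h1
  rw [← hn] at h2 ⊢
  lift n to ℕ using fun h => h2 (by rw [h]; rfl)
  exact ⟨n, rfl⟩

omit [IsNoetherianRing R] in
theorem nontrivial_quotient {xs : List R} [Nontrivial M] (h : ∀ x ∈ xs, x ∈ maximalIdeal R) :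
    Nontrivial (M ⧸ seqSMul M xs) :=
  Submodule.Quotient.nontrivial_iff.mpr
    (Submodule.top_ne_ideal_smul_of_le_jacobson_annihilator
      ((Ideal.span_le.mpr h).trans (maximalIdeal_le_jacobson _))).symm

theorem supportDim_le_add_length {xs : List R} (h : ∀ x ∈ xs, x ∈ maximalIdeal R) :
    Module.supportDim R M ≤ Module.supportDim R (M ⧸ seqSMul M xs) + xs.length := by
  induction xs generalizing M with
  | nil => simp [supportDim_quotient_nil]
  | cons x xs ih =>
    rw [supportDim_quotient_cons, List.length_cons, Nat.cast_add, Nat.cast_one, ← add_assoc]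
    exact (Module.supportDim_le_supportDim_quotSMulTop_succ (h x (by simp))).trans
      (by gcongr; exact ih _ fun y hy => h y (by simp [hy]))

theorem isParamSeq_cons_iff (x : R) (xs : List R) :
    IsParamSeq M (x :: xs) ↔ x ∈ maximalIdeal R ∧
      Module.supportDim R (QuotSMulTop x M) + 1 = Module.supportDim R M ∧
        IsParamSeq (QuotSMulTop x M) xs := by
  simp only [IsParamSeq]
  rw [supportDim_quotient_cons, List.length_cons, Nat.cast_add, Nat.cast_one, ← add_assoc]
  constructor
  · rintro ⟨hm, h⟩
    have hx : x ∈ maximalIdeal R := hm x (by simp)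
    have hxs : ∀ y ∈ xs, y ∈ maximalIdeal R := fun y hy => hm y (by simp [hy])
    have h1 := Module.supportDim_le_supportDim_quotSMulTop_succ (M := M) hx
    have h2 := supportDim_le_add_length (QuotSMulTop x M) hxs
    have h3 := ENat.WithBot.add_le_add_one_right_iff.mp (h.trans_le h1)
    have h4 := le_antisymm h2 h3
    exact ⟨hx, h4 ▸ h, hxs, h4.symm⟩
  · rintro ⟨hx, h, hm, h'⟩
    exact ⟨by simpa using ⟨hx, hm⟩, by rw [h', h]⟩

variable {M} in
theorem IsParamSeq.take {xs : List R} (h : IsParamSeq M xs) (i : ℕ) :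
    IsParamSeq M (xs.take i) := by
  induction xs generalizing M i with
  | nil => simpa using h
  | cons x xs ih =>
    cases i with
    | zero => exact isParamSeq_nil M
    | succ i =>
      rw [List.take_succ_cons, isParamSeq_cons_iff]
      rw [isParamSeq_cons_iff] at h
      exact ⟨h.1, h.2.1, ih h.2.2 i⟩

omit [IsNoetherianRing R] [IsLocalRing R] [Module.Finite R M] in
theorem exists_mem_support_le_dim_quotient {n : ℕ} (h : n ≤ Module.supportDim R M) :
    ∃ q ∈ Module.support R M, n ≤ ringKrullDim (R ⧸ q.asIdeal) := by
  obtain ⟨l, rfl⟩ := le_krullDim_iff.mp h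
  refine ⟨l.head, l.head.2, ?_⟩
  rw [ringKrullDim_quotient_eq_coheight_support l.head.2]
  exact WithBot.coe_le_coe.mpr (length_le_coheight_head)

omit [IsLocalRing R] in
/-- Prime avoidance for parameters: the finitely many primes to be avoided are the minimal primes
`q` of `M` with `dim R/q = dim M`. -/
theorem exists_mem_supportDim_quotSMulTop_lt {p : PrimeSpectrum R} {n : ℕ}
    (hn : Module.supportDim R M = n)
    (hp : ringKrullDim (R ⧸ p.asIdeal) < n) :
    ∃ x ∈ p.asIdeal, Module.supportDim R (QuotSMulTop x M) < n := by
  by_contra! hcon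
  let s : Set (Ideal R) := {q | q ∈ (Module.annihilator R M).minimalPrimes ∧
    (n : WithBot ℕ∞) ≤ ringKrullDim (R ⧸ q)}
  have hs : s.Finite := (Ideal.finite_minimalPrimes_of_isNoetherianRing R _).subset fun q hq => hq.1
  have hsub : (p.asIdeal : Set R) ⊆ ⋃ q ∈ s, (q : Set R) := by
    intro x hx
    obtain ⟨q, hq, hqn⟩ := exists_mem_support_le_dim_quotient _ (hcon x hx)
    rw [Module.support_quotSMulTop] at hq
    have hxq : x ∈ q.asIdeal := by simpa using hq.2
    obtain ⟨q₀, -, hle, hmin⟩ := exists_associatedPrime_le hq.1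
    have hq₀ : q₀ ∈ Module.support R M := Module.mem_support_iff_of_finite.mpr hmin.1.2
    -- A minimal prime `q₀` strictly below `q` would give a chain of length `n + 1`.
    have : q₀ = q := by
      by_contra hne
      have hlt : (⟨q₀, hq₀⟩ : Module.support R M) < ⟨q, hq.1⟩ := lt_of_le_of_ne hle (by simpa)
      have h1 := coheight_add_one_le hlt
      have h2 := coheight_le_krullDim (⟨q₀, hq₀⟩ : Module.support R M)
      rw [ringKrullDim_quotient_eq_coheight_support hq.1] at hqn
      have h3 : (n : WithBot ℕ∞) + 1 ≤ n := by
        calc (n : WithBot ℕ∞) + 1 ≤ (coheight (⟨q, hq.1⟩ : Module.support R M) : WithBot ℕ∞) + 1 := by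
              gcongr
          _ ≤ (coheight (⟨q₀, hq₀⟩ : Module.support R M) : WithBot ℕ∞) := by exact_mod_cast h1
          _ ≤ n := h2.trans_eq hn
      rw [ENat.WithBot.add_one_le_iff] at h3
      exact lt_irrefl _ h3
    subst this
    simp only [Set.mem_iUnion]
    exact ⟨q₀.asIdeal, ⟨hmin, hqn⟩, hxq⟩
  obtain ⟨q, hq, hpq⟩ := (Ideal.subset_union_prime_finite hs (f := id) ⊤ ⊤
    fun q hq _ _ => hq.1.isPrime).mp (by simpa using hsub)
  have := dim_quotient_anti (p := ⟨q, hq.1.isPrime⟩) (q := p) hpq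
  exact absurd (hq.2.trans this) (not_le.mpr hp)

/-- A prime `p` contains part of a system of parameters of any length up to `dim M - dim R/p`. -/
theorem exists_isParamSeq {p : PrimeSpectrum R} [Nontrivial M] (r : ℕ)
    (h : ringKrullDim (R ⧸ p.asIdeal) + r ≤ Module.supportDim R M) :
    ∃ xs : List R, xs.length = r ∧ (∀ x ∈ xs, x ∈ p.asIdeal) ∧ IsParamSeq M xs := by
  have hle : p.asIdeal ≤ maximalIdeal R := IsLocalRing.le_maximalIdeal p.2.ne_top
  induction r generalizing M with
  | zero => exact ⟨[], rfl, by simp, isParamSeq_nil M⟩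
  | succ r ih =>
    obtain ⟨n, hn⟩ := exists_supportDim_eq (R := R) M
    rw [Nat.cast_add, Nat.cast_one, ← add_assoc] at h
    have hlt : ringKrullDim (R ⧸ p.asIdeal) < n := by
      rw [← ENat.WithBot.add_one_le_natCast_iff, ← hn]
      refine le_trans ?_ h
      gcongr
      exact le_add_of_nonneg_right (by exact_mod_cast Nat.zero_le r)
    obtain ⟨x, hx, hxn⟩ := exists_mem_supportDim_quotSMulTop_lt M hn hlt
    have hxm := hle hx
    have heq : Module.supportDim R (QuotSMulTop x M) + 1 = Module.supportDim R M :=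
      le_antisymm (by rw [hn]; exact ENat.WithBot.add_one_le_natCast_iff.mpr hxn)
        (Module.supportDim_le_supportDim_quotSMulTop_succ hxm)
    have : Nontrivial (QuotSMulTop x M) := nontrivial_quotSMulTop_of_mem_maximalIdeal M hxm
    obtain ⟨xs, hlen, hmem, hxs⟩ := ih (QuotSMulTop x M)
      (by rwa [← heq, ENat.WithBot.add_le_add_one_right_iff] at h)
    refine ⟨x :: xs, by simp [hlen], by simpa using ⟨hx, hmem⟩, ?_⟩
    exact (isParamSeq_cons_iff M x xs).mpr ⟨hxm, heq, hxs⟩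

omit [IsNoetherianRing R] in
theorem dim_quotient_closedPoint : ringKrullDim (R ⧸ (closedPoint R).asIdeal) = 0 :=
  ringKrullDim_eq_zero_of_field (IsLocalRing.ResidueField R)

variable {M}

/-- Part of a system of parameters extends to a full one. -/
theorem IsParamSeq.exists_append [Nontrivial M] {xs : List R} (h : IsParamSeq M xs) :
    ∃ ys : List R, IsParamSeq M (xs ++ ys) ∧
      ((xs ++ ys).length : WithBot ℕ∞) = Module.supportDim R M := by
  induction xs generalizing M with
  | nil =>
    obtain ⟨n, hn⟩ := exists_supportDim_eq (R := R) M
    obtain ⟨ys, hlen, -, hys⟩ := exists_isParamSeq M (p := closedPoint R) n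
      (by rw [dim_quotient_closedPoint, hn, zero_add])
    exact ⟨ys, hys, by simp [hlen, hn]⟩
  | cons x xs ih =>
    obtain ⟨hx, heq, hxs⟩ := (isParamSeq_cons_iff M x xs).mp h
    have : Nontrivial (QuotSMulTop x M) := nontrivial_quotSMulTop_of_mem_maximalIdeal M hx
    obtain ⟨ys, hys, hlen⟩ := ih hxs
    refine ⟨ys, (isParamSeq_cons_iff M x (xs ++ ys)).mpr ⟨hx, heq, hys⟩, ?_⟩
    rw [List.cons_append, List.length_cons, Nat.cast_add, Nat.cast_one, hlen, heq]

omit [IsLocalRing R] in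
theorem isFiniteLength_of_supportDim_nonpos (h : Module.supportDim R M ≤ 0) :
    IsFiniteLength R M := by
  have hmax : ∀ p ∈ Module.support R M, p.asIdeal.IsMaximal := by
    intro p hp
    have hM := krullDim_nonpos_iff_forall_isMax.mp h ⟨p, hp⟩
    obtain ⟨m, hm, hpm⟩ := Ideal.exists_le_maximal _ p.2.ne_top
    let m' : PrimeSpectrum R := ⟨m, hm.isPrime⟩
    have h1 : p ≤ m' := hpm
    have h2 : m' ≤ p := hM (b := ⟨m', Module.mem_support_mono h1 hp⟩) h1
    rwa [show p = m' from le_antisymm h1 h2]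
  clear h
  rename_i hfin
  induction hfin using IsNoetherianRing.induction_on_isQuotientEquivQuotientPrime R with
  | subsingleton N => exact .of_subsingleton
  | quotient N p e =>
    have hp : p ∈ Module.support R N := by
      rw [e.support_eq, Module.support_eq_zeroLocus, Ideal.annihilator_quotient]
      exact fun _ hx => hx
    have := hmax p hp
    have hs : IsSimpleModule R (R ⧸ p.asIdeal) := isSimpleModule_iff_isCoatom.mpr this.out
    exact e.symm.isFiniteLength (isFiniteLength_iff_isNoetherian_isArtinian.mpr
      ⟨inferInstance, inferInstance⟩)
  | exact N₁ N₂ N₃ f g hf hg hfg h₁ h₃ =>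
    have i₁ := isFiniteLength_iff_isNoetherian_isArtinian.mp
      (h₁ fun p hp => hmax p (Module.support_subset_of_injective f hf hp))
    have i₃ := isFiniteLength_iff_isNoetherian_isArtinian.mp
      (h₃ fun p hp => hmax p (Module.support_subset_of_surjective g hg hp))
    have := i₁.2
    have := i₃.2
    exact isFiniteLength_iff_isNoetherian_isArtinian.mpr
      ⟨inferInstance, isArtinian_of_range_eq_ker f g hfg.linearMap_ker_eq.symm⟩

omit [IsLocalRing R] in
theorem supportDim_nonpos_of_isFiniteLength (h : IsFiniteLength R M) :
    Module.supportDim R M ≤ 0 := by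
  refine krullDim_nonpos_iff_forall_isMax.mpr fun ⟨p, hp⟩ ⟨p', hp'⟩ hpp' => ?_
  obtain ⟨q, hq, hqp, -⟩ := exists_associatedPrime_le hp
  obtain ⟨-, f, hf⟩ := (isAssociatedPrime_iff_exists_injective_linearMap q.asIdeal M).mp hq
  have hart := (isFiniteLength_iff_isNoetherian_isArtinian.mp (h.of_injective hf)).2
  have : IsArtinianRing (R ⧸ q.asIdeal) := isArtinian_of_tower R hart
  have hmax : q.asIdeal.IsMaximal :=
    Ideal.Quotient.maximal_of_isField _ (IsArtinianRing.isField_of_isDomain _)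
  have h1 : q = p' := PrimeSpectrum.ext (hmax.eq_of_le p'.2.ne_top (hqp.trans hpp'))
  exact h1 ▸ hqp

theorem isSystemOfParameters_iff {xs : List R} :
    IsSystemOfParameters M xs ↔
      IsParamSeq M xs ∧ (xs.length : WithBot ℕ∞) = Module.supportDim R M := by
  constructor
  · rintro ⟨hlen, hmem, hfin⟩
    refine ⟨⟨hmem, le_antisymm ?_ (supportDim_le_add_length M hmem)⟩, hlen⟩
    rw [← hlen]
    calc _ ≤ (0 : WithBot ℕ∞) + xs.length := by
          gcongr
          exact supportDim_nonpos_of_isFiniteLength hfin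
      _ = _ := zero_add _
  · rintro ⟨⟨hmem, heq⟩, hlen⟩
    refine ⟨hlen, hmem, isFiniteLength_of_supportDim_nonpos ?_⟩
    rw [← hlen] at heq
    exact ENat.WithBot.add_le_add_natCast_right_iff.mp (heq.trans (zero_add _).symm).le

end Parameters

end SerreCM

namespace SerreCM

open CategoryTheory Abelian

/-! ### Ext modules modulo a Serre class -/

section Ext

variable {R : Type u} [CommRing R] (S : ObjectProperty (ModuleCat.{u} R)) [S.IsSerreClass]

/-- `Ext i A N` lies in the Serre class if `N` does: its support lies in that of `N`. -/
theorem prop_ext_of_prop [IsNoetherianRing R] (A N : Type u) [AddCommGroup A] [Module R A]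
    [AddCommGroup N] [Module R N] [Module.Finite R A] [Module.Finite R N]
    (h : S (ModuleCat.of R N)) (i : ℕ) :
    S (ModuleCat.of R (Ext (ModuleCat.of R A) (ModuleCat.of R N) i)) := by
  refine (prop_iff_support S).mpr fun p hp => (prop_iff_support S).mp h p ?_
  rw [Module.mem_support_iff_of_finite] at hp ⊢
  refine le_trans (fun r hr => Module.mem_annihilator.mpr fun e => ?_) hp
  have h0 : r • 𝟙 (ModuleCat.of R N) = 0 := by
    ext n
    exact Module.mem_annihilator.mp hr n
  have : r • e = e.comp (Ext.mk₀ (r • 𝟙 (ModuleCat.of R N))) (add_zero i) := by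
    simp [Ext.mk₀_smul]
  rw [this, h0, Ext.mk₀_zero, Ext.comp_zero]

variable {A : ModuleCat.{u} R} {T : ShortComplex (ModuleCat.{u} R)}

theorem ext_exact₂ (hT : T.ShortExact) (i : ℕ) :
    Function.Exact ((Ext.mk₀ T.f).postcompOfLinear R A (add_zero i))
      ((Ext.mk₀ T.g).postcompOfLinear R A (add_zero i)) := fun x => by
  constructor
  · exact fun h => Ext.covariant_sequence_exact₂ A hT x h
  · rintro ⟨y, rfl⟩
    simp

theorem ext_exact₃ (hT : T.ShortExact) (i : ℕ) :
    Function.Exact ((Ext.mk₀ T.g).postcompOfLinear R A (add_zero i))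
      (hT.extClass.postcompOfLinear R A (rfl : i + 1 = i + 1)) := fun x => by
  constructor
  · exact fun h => Ext.covariant_sequence_exact₃ A hT x rfl h
  · rintro ⟨y, rfl⟩
    simp

theorem ext_exact₁ (hT : T.ShortExact) (i : ℕ) :
    Function.Exact (hT.extClass.postcompOfLinear R A (rfl : i + 1 = i + 1))
      ((Ext.mk₀ T.f).postcompOfLinear R A (add_zero (i + 1))) := fun x => by
  constructor
  · exact fun h => Ext.covariant_sequence_exact₁ A hT x h rfl
  · rintro ⟨y, rfl⟩
    simp

/-- If `π : B → C` followed by `ι : C → D` vanishes, then `B` lies in the Serre class as soon as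
`ker π` and `ker ι` do. -/
theorem prop_of_comp_eq_zero {A B C D E : Type u} [AddCommGroup A] [Module R A] [AddCommGroup B]
    [Module R B] [AddCommGroup C] [Module R C] [AddCommGroup D] [Module R D] [AddCommGroup E]
    [Module R E] (f : A →ₗ[R] B) (π : B →ₗ[R] C) (g : E →ₗ[R] C) (ι : C →ₗ[R] D)
    (hfπ : Function.Exact f π) (hgι : Function.Exact g ι) (h0 : ∀ b, ι (π b) = 0)
    (hA : S (ModuleCat.of R A)) (hE : S (ModuleCat.of R E)) : S (ModuleCat.of R B) := by
  have hker : S (ModuleCat.of R (LinearMap.ker ι)) :=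
    prop_of_surjective S (g.codRestrict (LinearMap.ker ι) fun e => hgι.apply_apply_eq_zero e)
      (fun ⟨c, hc⟩ => by
        obtain ⟨e, rfl⟩ := (hgι c).mp hc
        exact ⟨e, rfl⟩) hE
  refine prop_of_exact S f (π.codRestrict (LinearMap.ker ι) h0) (fun b => ?_) hA hker
  rw [← hfπ b, ← Subtype.coe_inj]
  rfl

/-- Passing from `M` to `M / x M` lowers the `Ext` grade modulo `S` by one, when `x` kills the first
argument and has kernel in `S` on `M`. With `K = ker x` this splits `0 → K → M → M → M / x M → 0`
into two short exact sequences through `x M`. -/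
theorem prop_ext_succ_iff [IsNoetherianRing R] (A M : Type u) [AddCommGroup A] [Module R A]
    [AddCommGroup M] [Module R M] [Module.Finite R A] [Module.Finite R M] {x : R}
    (hxA : x ∈ Module.annihilator R A)
    (hx : S (ModuleCat.of R (LinearMap.ker (LinearMap.lsmul R M x)))) (n : ℕ) :
    (∀ i < n + 1, S (ModuleCat.of R (Ext (ModuleCat.of R A) (ModuleCat.of R M) i))) ↔
      ∀ i < n, S (ModuleCat.of R (Ext (ModuleCat.of R A)
        (ModuleCat.of R (QuotSMulTop x M)) i)) := by
  let q : M →ₗ[R] QuotSMulTop x M := Submodule.mkQ _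
  have hq : ∀ m : M, q m = 0 ↔ ∃ m', x • m' = m := fun m => by
    rw [Submodule.mkQ_apply, Submodule.Quotient.mk_eq_zero, Submodule.mem_smul_pointwise_iff_exists]
    simp
  let π : M →ₗ[R] LinearMap.ker q :=
    (LinearMap.lsmul R M x).codRestrict _ fun m => (hq _).mpr ⟨m, rfl⟩
  have hπ : Function.Surjective π := fun ⟨m, hm⟩ => by
    obtain ⟨m', rfl⟩ := (hq m).mp hm
    exact ⟨m', rfl⟩
  have hT₁ := LinearMap.shortExact_shortComplexKer hπ
  have hT₂ := LinearMap.shortExact_shortComplexKer (f := q) (Submodule.mkQ_surjective _)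
  have hker : LinearMap.ker π = LinearMap.ker (LinearMap.lsmul R M x) :=
    LinearMap.ker_codRestrict _ _ _
  have hK : ∀ i, S (ModuleCat.of R (Ext (ModuleCat.of R A)
      (ModuleCat.of R (LinearMap.ker π)) i)) := by
    rw [hker]
    exact prop_ext_of_prop S A _ hx
  have hcomp : π.shortComplexKer.g ≫ q.shortComplexKer.f = x • 𝟙 (ModuleCat.of R M) := by
    ext m
    rfl
  have h0 : ∀ i (e : Ext (ModuleCat.of R A) (ModuleCat.of R M) i),
      (Ext.mk₀ q.shortComplexKer.f).postcompOfLinear R (ModuleCat.of R A) (add_zero i)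
        ((Ext.mk₀ π.shortComplexKer.g).postcompOfLinear R (ModuleCat.of R A) (add_zero i) e) =
          0 := by
    intro i e
    have := Ext.postcomp_smul_id_eq_zero_of_mem_annihilator (M := ModuleCat.of R M)
      (N := ModuleCat.of R A) hxA i
    have h2 := congrArg (fun φ => φ.hom e) this
    simp only [LinearMap.flip_apply, Ext.bilinearCompOfLinear_apply_apply]
    rw [Ext.comp_assoc_of_third_deg_zero, Ext.mk₀_comp_mk₀, hcomp]
    exact h2
  constructor
  · intro h i hi
    refine prop_of_exact S _ _ (ext_exact₃ hT₂ i) (h i (by omega)) ?_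
    exact prop_of_exact S _ _ (ext_exact₃ hT₁ (i + 1)) (h (i + 1) (by omega)) (hK _)
  · intro h i hi
    cases i with
    | zero =>
      refine prop_of_comp_eq_zero S (E := PUnit.{u + 1}) _ _ 0 _ (ext_exact₂ hT₁ 0) ?_ (h0 0) (hK 0)
        (prop_of_subsingleton S)
      rw [LinearMap.exact_zero_iff_injective]
      have := hT₂.mono_f
      exact Ext.postcomp_mk₀_injective_of_mono _ _
    | succ i =>
      exact prop_of_comp_eq_zero S _ _ _ _ (ext_exact₂ hT₁ (i + 1)) (ext_exact₁ hT₂ i) (h0 (i + 1))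
        (hK (i + 1)) (h i (by omega))

variable {S} in
/-- If `Hom(R/a, M)` lies in the Serre class, then some `x ∈ a` avoids the associated primes of `M`
outside the class. -/
theorem exists_prop_ker_of_prop_hom [IsNoetherianRing R] {a : Ideal R} {M : Type u}
    [AddCommGroup M] [Module R M] [Module.Finite R M]
    (h : S (ModuleCat.of R (Ext (ModuleCat.of R (R ⧸ a)) (ModuleCat.of R M) 0))) :
    ∃ x ∈ a, S (ModuleCat.of R (LinearMap.ker (LinearMap.lsmul R M x))) := by
  have hHom : S (ModuleCat.of R ((R ⧸ a) →ₗ[R] M)) :=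
    prop_of_surjective S (Ext.linearEquiv₀.trans ModuleCat.homLinearEquiv).toLinearMap
      (LinearEquiv.surjective _) h
  by_contra! hcon
  have hs : {q : Ideal R | q ∈ associatedPrimes R M ∧ ¬ S (ModuleCat.of R (R ⧸ q))}.Finite :=
    (associatedPrimes.finite R M).subset fun q hq => hq.1
  have hsub : (a : Set R) ⊆
      ⋃ q ∈ {q : Ideal R | q ∈ associatedPrimes R M ∧ ¬ S (ModuleCat.of R (R ⧸ q))},
        (q : Set R) := by
    intro x hx
    have := hcon x hx
    rw [prop_ker_iff S] at this
    push Not at this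
    obtain ⟨q, hq, hxq⟩ := this
    simp only [Set.mem_iUnion]
    exact ⟨q.asIdeal, hq, hxq⟩
  obtain ⟨q, ⟨hq, hqS⟩, haq⟩ := (Ideal.subset_union_prime_finite hs (f := id) ⊤ ⊤
    fun q hq _ _ => IsAssociatedPrime.isPrime hq.1).mp (by simpa using hsub)
  obtain ⟨hprime, j, hj⟩ := (isAssociatedPrime_iff_exists_injective_linearMap q M).mp hq
  refine hqS ((prop_iff_associatedPrimes S).mp hHom ⟨q, hprime⟩ ?_)
  rw [AssociatedPrimes.mem_iff, isAssociatedPrime_iff]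
  -- The composite `R/a → R/q → M` is a homomorphism with annihilator `q`.
  refine ⟨hprime, j ∘ₗ (Ideal.Quotient.factorₐ R haq).toLinearMap, ?_⟩
  ext r
  rw [Submodule.mem_colon_singleton, Submodule.mem_bot]
  constructor
  · intro hr
    ext
    have : r • (1 : R ⧸ q) = 0 := by
      rw [Algebra.smul_def, mul_one]
      exact Ideal.Quotient.eq_zero_iff_mem.mpr hr
    simp [← map_smul, this]
  · intro hr
    have h1 := LinearMap.congr_fun hr 1
    simp only [LinearMap.smul_apply, LinearMap.comp_apply, AlgHom.toLinearMap_apply, map_one,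
      LinearMap.zero_apply, ← map_smul] at h1
    rw [map_eq_zero_iff j hj, Algebra.smul_def, mul_one] at h1
    exact Ideal.Quotient.eq_zero_iff_mem.mp h1

/-- Rees' theorem modulo a Serre class: `Extⁱ(R/a, M) ∈ S` for all `i < n` iff `a` contains a weak
`M`-sequence of length `n` with respect to `S`. -/
theorem forall_prop_ext_iff_exists_isWeakSeq [IsNoetherianRing R] (a : Ideal R) (M : Type u)
    [AddCommGroup M] [Module R M] [Module.Finite R M] (n : ℕ) :
    (∀ i < n, S (ModuleCat.of R (Ext (ModuleCat.of R (R ⧸ a)) (ModuleCat.of R M) i))) ↔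
      ∃ xs : List R, xs.length = n ∧ (∀ x ∈ xs, x ∈ a) ∧ IsWeakSeq S M xs := by
  have hann : ∀ x ∈ a, x ∈ Module.annihilator R (R ⧸ a) := fun x hx => by
    rwa [Ideal.annihilator_quotient]
  induction n generalizing M with
  | zero => exact ⟨fun _ => ⟨[], rfl, by simp, fun i hi => absurd hi (by simp)⟩,
      fun _ i hi => absurd hi (by omega)⟩
  | succ n ih =>
    constructor
    · intro h
      obtain ⟨x, hx, hker⟩ := exists_prop_ker_of_prop_hom (h 0 (by omega))
      obtain ⟨xs, hlen, hmem, hxs⟩ :=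
        (ih (QuotSMulTop x M)).mp ((prop_ext_succ_iff S _ M (hann x hx) hker n).mp h)
      exact ⟨x :: xs, by simp [hlen], by simpa using ⟨hx, hmem⟩,
        (isWeakSeq_cons_iff S x xs).mpr ⟨hker, hxs⟩⟩
    · rintro ⟨_ | ⟨x, xs⟩, hlen, hmem, hxs⟩
      · simp at hlen
      · obtain ⟨hker, hxs⟩ := (isWeakSeq_cons_iff S x xs).mp hxs
        exact (prop_ext_succ_iff S _ M (hann x (hmem x (by simp))) hker n).mpr
          ((ih (QuotSMulTop x M)).mpr ⟨xs, by simpa using hlen,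
            fun y hy => hmem y (by simp [hy]), hxs⟩)

end Ext

end SerreCM

namespace SerreCM

open IsLocalRing RingTheory.Sequence CategoryTheory

/-! ### Cohen–Macaulay modules over a Noetherian local ring -/

section ZeroClass

variable {R : Type u} [CommRing R] [IsNoetherianRing R]

/-- The Serre class of zero modules. -/
abbrev zeroClass (R : Type u) [CommRing R] : ObjectProperty (ModuleCat.{u} R) :=
  Limits.IsZero

omit [IsNoetherianRing R] in
theorem not_zeroClass_quotient (p : PrimeSpectrum R) :
    ¬ zeroClass R (ModuleCat.of R (R ⧸ p.asIdeal)) := fun h => by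
  have := ModuleCat.subsingleton_of_isZero h
  exact not_subsingleton (R ⧸ p.asIdeal) this

theorem forall_sAss_zeroClass_notMem_iff {M : Type u} [AddCommGroup M] [Module R M] (x : R) :
    (∀ q ∈ sAss (zeroClass R) M, x ∉ q.asIdeal) ↔ IsSMulRegular M x := by
  have h : x ∈ ⋃ p ∈ associatedPrimes R M, (p : Set R) ↔ x ∈ {r : R | IsSMulRegular M r}ᶜ := by
    rw [biUnion_associatedPrimes_eq_compl_regular]
  rw [← not_iff_not, ← Set.mem_ofPred (p := fun r : R => IsSMulRegular M r), ← Set.mem_compl_iff,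
    ← h]
  simp only [Set.mem_iUnion]
  push Not
  constructor
  · rintro ⟨q, hq, hx⟩
    exact ⟨q.asIdeal, hq.1, hx⟩
  · rintro ⟨q, hq, hx⟩
    exact ⟨⟨q, IsAssociatedPrime.isPrime hq⟩, ⟨hq, not_zeroClass_quotient _⟩, hx⟩

theorem isWeakSeq_zeroClass_iff {M : Type u} [AddCommGroup M] [Module R M] [Module.Finite R M]
    (xs : List R) : IsWeakSeq (zeroClass R) M xs ↔ IsWeaklyRegular M xs := by
  rw [isWeakSeq_iff, isWeaklyRegular_iff]
  exact forall₂_congr fun i hi => forall_sAss_zeroClass_notMem_iff _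

end ZeroClass

section CohenMacaulay

variable {R : Type u} [CommRing R] [IsNoetherianRing R] [IsLocalRing R]
  {M : Type u} [AddCommGroup M] [Module R M] [Module.Finite R M]

variable (M) in
/-- There is a weakly regular sequence of length `n` in the maximal ideal; for `M ≠ 0` this says
`n ≤ depth M`. -/
def HasRegularSeq (n : ℕ) : Prop :=
  ∃ xs : List R, xs.length = n ∧ (∀ x ∈ xs, x ∈ maximalIdeal R) ∧ IsWeaklyRegular M xs

omit [IsNoetherianRing R] in
theorem natCast_le_depth_iff [Nontrivial M] (n : ℕ) :
    (n : ℕ∞) ≤ depth R M ↔ HasRegularSeq (R := R) M n := by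
  constructor
  · intro h
    cases n with
    | zero => exact ⟨[], rfl, by simp, by simp⟩
    | succ n =>
      have h1 : (n : ℕ∞) < depth R M := lt_of_lt_of_le (by exact_mod_cast n.lt_succ_self) h
      simp only [depth, lt_iSup_iff] at h1
      obtain ⟨xs, hmem, hreg, hlen⟩ := h1
      have hlen : n < xs.length := by exact_mod_cast hlen
      refine ⟨xs.take (n + 1), by simp; omega, fun x hx => hmem x (List.mem_of_mem_take hx), ?_⟩
      have := hreg.toIsWeaklyRegular
      rw [← List.take_append_drop (n + 1) xs, isWeaklyRegular_append_iff] at this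
      exact this.1
  · rintro ⟨xs, rfl, hmem, hreg⟩
    exact le_iSup_of_le xs (le_iSup_of_le hmem
      (le_iSup_of_le (.of_isWeaklyRegular_of_mem_maximalIdeal M hmem hreg) le_rfl))

theorem depth_le_supportDim [Nontrivial M] :
    (depth R M : WithBot ℕ∞) ≤ Module.supportDim R M := by
  obtain ⟨n, hn⟩ := exists_supportDim_eq (R := R) M
  rw [hn]
  change (depth R M : WithBot ℕ∞) ≤ ((n : ℕ∞) : WithBot ℕ∞)
  rw [WithBot.coe_le_coe]
  refine iSup_le fun xs => iSup_le fun hmem => iSup_le fun hreg => ?_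
  have h := Module.supportDim_add_length_eq_supportDim_of_isRegular xs hreg
  have := nontrivial_quotient M hmem
  obtain ⟨m, hm⟩ := exists_supportDim_eq (R := R) (M ⧸ seqSMul M xs)
  rw [seqSMul] at hm
  rw [hm, hn] at h
  have h : m + xs.length = n := by exact_mod_cast h
  exact_mod_cast (by omega : xs.length ≤ n)

/-- If `x` is regular on `M`, every `q ∈ Ass M` is contained in some `q' ∈ Ass (M / x M)`
containing `x`: the submodule `N` of the elements killed by `q` satisfies `N ∩ x M = x N ≠ N`. -/
theorem exists_associatedPrime_quotSMulTop {x : R} (hx : x ∈ maximalIdeal R)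
    (hreg : IsSMulRegular M x) {q : Ideal R} (hq : q ∈ associatedPrimes R M) :
    ∃ q' ∈ associatedPrimes R (QuotSMulTop x M), q ≤ q' ∧ x ∈ q' := by
  let N := Submodule.torsionBySet R M q
  have hN : ∀ m, m ∈ N ↔ ∀ r ∈ q, r • m = 0 := fun m => by
    rw [Submodule.mem_torsionBySet_iff]
    simp
  have hne : Nontrivial N := by
    rw [AssociatedPrimes.mem_iff, isAssociatedPrime_iff] at hq
    obtain ⟨hprime, y, hy⟩ := hq
    have hyN : y ∈ N := (hN y).mpr fun r hr => by
      rw [hy] at hr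
      simpa [Submodule.mem_colon_singleton] using hr
    refine ⟨⟨y, hyN⟩, 0, fun h => hprime.ne_top ?_⟩
    have : y = 0 := congrArg Subtype.val h
    rw [hy, this]
    simp
  have := nontrivial_quotSMulTop_of_mem_maximalIdeal N hx
  obtain ⟨n, hn⟩ := exists_ne (0 : QuotSMulTop x N)
  obtain ⟨n, rfl⟩ := Submodule.Quotient.mk_surjective _ n
  have hn' : (Submodule.Quotient.mk n.1 : QuotSMulTop x M) ≠ 0 := by
    intro h0
    refine hn ?_
    rw [Submodule.Quotient.mk_eq_zero, Submodule.mem_smul_pointwise_iff_exists] at h0 ⊢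
    obtain ⟨m, -, hm⟩ := h0
    refine ⟨⟨m, (hN m).mpr fun r hr => ?_⟩, trivial, Subtype.ext hm⟩
    refine hreg.right_eq_zero_of_smul ?_
    rw [smul_comm, hm]
    exact (hN _).mp n.2 r hr
  obtain ⟨P, hP, hle⟩ := exists_le_isAssociatedPrime_of_isNoetherianRing R _ hn'
  refine ⟨P, hP, fun r hr => hle ?_, hle ?_⟩
  · rw [Submodule.mem_colon_singleton, ← Submodule.Quotient.mk_smul, (hN _).mp n.2 r hr]
    simp
  · rw [Submodule.mem_colon_singleton, Submodule.mem_bot]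
    exact Module.mem_annihilator.mp (QuotSMulTop.mem_annihilator M x) _

/-- `depth M ≤ dim R/q` for every `q ∈ Ass M`, by induction on a regular sequence: dividing by `x`
replaces `q` by a strictly larger associated prime. -/
theorem length_le_dim_quotient_associatedPrime {xs : List R} (hmem : ∀ x ∈ xs, x ∈ maximalIdeal R)
    (hreg : IsWeaklyRegular M xs) {q : PrimeSpectrum R} (hq : q.asIdeal ∈ associatedPrimes R M) :
    (xs.length : WithBot ℕ∞) ≤ ringKrullDim (R ⧸ q.asIdeal) := by
  induction xs generalizing M q with
  | nil =>
    rw [ringKrullDim_quotient_eq_coheight]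
    exact WithBot.coe_le_coe.mpr (by simp)
  | cons x xs ih =>
    obtain ⟨hx, hxs⟩ := (isWeaklyRegular_cons_iff M x xs).mp hreg
    obtain ⟨q', hq', hle, hxq'⟩ := exists_associatedPrime_quotSMulTop (hmem x (by simp)) hx hq
    have h1 := ih (fun y hy => hmem y (by simp [hy])) hxs
      (q := ⟨q', IsAssociatedPrime.isPrime hq'⟩) hq'
    have hxq : x ∉ q.asIdeal := fun h => by
      have : x ∈ {r : R | IsSMulRegular M r}ᶜ := by
        rw [← biUnion_associatedPrimes_eq_compl_regular]
        simp only [Set.mem_iUnion]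
        exact ⟨_, hq, h⟩
      exact this hx
    have hlt : q < ⟨q', IsAssociatedPrime.isPrime hq'⟩ :=
      lt_of_le_of_ne hle fun h => hxq (h ▸ hxq')
    have h2 := Order.coheight_add_one_le hlt
    rw [ringKrullDim_quotient_eq_coheight] at h1 ⊢
    rw [List.length_cons, Nat.cast_add, Nat.cast_one]
    refine le_trans (b := ((Order.coheight (⟨q', IsAssociatedPrime.isPrime hq'⟩ :
      PrimeSpectrum R) + 1 : ℕ∞) : WithBot ℕ∞)) ?_ (WithBot.coe_le_coe.mpr h2)
    rw [WithBot.coe_add, WithBot.coe_one]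
    gcongr

/-- Dividing by a regular element lowers the depth by at most one. -/
theorem HasRegularSeq.quotSMulTop {n : ℕ} (h : HasRegularSeq (R := R) M (n + 1)) {x : R}
    (hx : x ∈ maximalIdeal R) (hreg : IsSMulRegular M x) :
    HasRegularSeq (R := R) (QuotSMulTop x M) n := by
  have key : ∀ (N : Type u) [AddCommGroup N] [Module R N] [Module.Finite R N] (k : ℕ),
      HasRegularSeq (R := R) N k ↔ ∀ i < k, zeroClass R (ModuleCat.of R (Abelian.Ext
        (ModuleCat.of R (R ⧸ maximalIdeal R)) (ModuleCat.of R N) i)) := by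
    intro N _ _ _ k
    rw [forall_prop_ext_iff_exists_isWeakSeq]
    simp only [isWeakSeq_zeroClass_iff]
    rfl
  rw [key] at h ⊢
  refine (prop_ext_succ_iff (zeroClass R) _ M ?_ ?_ n).mp h
  · rwa [Ideal.annihilator_quotient]
  · rw [prop_ker_iff (zeroClass R), forall_sAss_zeroClass_notMem_iff]
    exact hreg

/-- On a Cohen–Macaulay module every part of a system of parameters is a regular sequence, and the
quotient is again Cohen–Macaulay. -/
theorem HasRegularSeq.of_isParamSeq [Nontrivial M] {n : ℕ} (h : HasRegularSeq (R := R) M n)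
    (hn : Module.supportDim R M = n) {xs : List R} (hxs : IsParamSeq M xs) :
    IsWeaklyRegular M xs ∧ ∃ k, k + xs.length = n ∧
      HasRegularSeq (R := R) (M ⧸ seqSMul M xs) k := by
  induction xs generalizing M n with
  | nil =>
    refine ⟨by simp, n, rfl, ?_⟩
    obtain ⟨ys, hlen, hmem, hys⟩ := h
    exact ⟨ys, hlen, hmem, (LinearEquiv.isWeaklyRegular_congr
      (Submodule.quotEquivOfEqBot _ (by simp [seqSMul])) ys).mpr hys⟩
  | cons x xs ih =>
    obtain ⟨hx, heq, hxs'⟩ := (isParamSeq_cons_iff M x xs).mp hxs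
    have : Nontrivial (QuotSMulTop x M) := nontrivial_quotSMulTop_of_mem_maximalIdeal M hx
    obtain ⟨m, hm⟩ := exists_supportDim_eq (R := R) (QuotSMulTop x M)
    have hmn : m + 1 = n := by
      rw [hm, hn] at heq
      exact_mod_cast heq
    subst hmn
    -- All associated primes `q` have `dim R/q = dim M`, so a parameter avoids them.
    have hreg : IsSMulRegular M x := by
      rw [← forall_sAss_zeroClass_notMem_iff]
      intro q hq hxq
      obtain ⟨ys, hlen, hmem, hys⟩ := h
      have h1 := length_le_dim_quotient_associatedPrime hmem hys hq.1
      have h2 : ringKrullDim (R ⧸ q.asIdeal) ≤ Module.supportDim R (QuotSMulTop x M) := by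
        refine dim_quotient_le_supportDim ?_
        rw [Module.support_quotSMulTop]
        exact ⟨mem_support_of_mem_associatedPrimes hq.1, by simpa using hxq⟩
      rw [hlen] at h1
      have h3 := h1.trans (h2.trans_eq hm)
      have h4 : m + 1 ≤ m := by exact_mod_cast h3
      omega
    obtain ⟨h1, k, hk, hq⟩ := ih (h.quotSMulTop hx hreg) hm hxs'
    refine ⟨(isWeaklyRegular_cons_iff M x xs).mpr ⟨hreg, h1⟩, k, by simp; omega, ?_⟩
    obtain ⟨ys, hlen, hmem, hys⟩ := hq
    exact ⟨ys, hlen, hmem, (LinearEquiv.isWeaklyRegular_congr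
      (Submodule.quotOfListConsSMulTopEquivQuotSMulTopInner M x xs) ys).mpr hys⟩

end CohenMacaulay

end SerreCM

namespace SerreCM

open IsLocalRing RingTheory.Sequence CategoryTheory

/-! ### The equivalent conditions -/

section Conditions

variable {R : Type u} [CommRing R] [IsNoetherianRing R]
  (S : ObjectProperty (ModuleCat.{u} R)) [S.IsSerreClass]
  {M : Type u} [AddCommGroup M] [Module R M] [Module.Finite R M]

omit [S.IsSerreClass] [IsNoetherianRing R] [Module.Finite R M] in
theorem IsWeakSeq.of_append {xs ys : List R} (h : IsWeakSeq S M (xs ++ ys)) :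
    IsWeakSeq S M xs := by
  intro i hi
  have h' := h i (by simp; omega)
  rwa [List.take_append_of_le_length hi.le, List.getElem_append_left hi] at h'

omit [IsNoetherianRing R] [Module.Finite R M] in
theorem nontrivial_localizedAt {p : PrimeSpectrum R} (hp : p ∈ Module.support R M) :
    Nontrivial (localizedAt M p) := Module.mem_support_iff.mp hp

omit [Module.Finite R M] in
theorem exists_ht_eq {p : PrimeSpectrum R} (hp : p ∈ Module.support R M) :
    ∃ h : ℕ, ht M p = h := by
  have := nontrivial_localizedAt hp
  exact exists_supportDim_eq (R := Localization.AtPrime p.asIdeal) (localizedAt M p)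

theorem depth_localizedAt_le_ht {p : PrimeSpectrum R} (hp : p ∈ Module.support R M) :
    (depth (Localization.AtPrime p.asIdeal) (localizedAt M p) : WithBot ℕ∞) ≤ ht M p := by
  have := nontrivial_localizedAt hp
  exact depth_le_supportDim

variable {S} in
theorem IsWeakSeq.length_le_depth {xs : List R} (h : IsWeakSeq S M xs) {p : PrimeSpectrum R}
    (hp : p ∈ sSupp S M) (hmem : ∀ x ∈ xs, x ∈ p.asIdeal) :
    (xs.length : ℕ∞) ≤ depth (Localization.AtPrime p.asIdeal) (localizedAt M p) := by
  have := nontrivial_localizedAt hp.1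
  rw [natCast_le_depth_iff]
  refine ⟨_, List.length_map _, fun y hy => ?_, h.isWeaklyRegular S p hp.2⟩
  obtain ⟨x, hx, rfl⟩ := List.mem_map.mp hy
  exact (IsLocalization.AtPrime.to_map_mem_maximal_iff _ p.asIdeal x).mpr (hmem x hx)

omit [IsNoetherianRing R] [S.IsSerreClass] [Module.Finite R M] in
theorem sHt_eq_ht {p : PrimeSpectrum R} (hp : p ∈ sSupp S M) : sHt S M p.asIdeal = ht M p :=
  le_antisymm (iInf₂_le p ⟨hp, fun _ hx => hx⟩) (le_iInf₂ fun _ hq => ht_mono hq.2)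

variable {S} in
/-- The `Ext` grade bounds the depth of the localization from below. -/
theorem le_depth_of_le_sExtGrade {p : PrimeSpectrum R} (hp : p ∈ sSupp S M) {n : ℕ}
    (h : (n : ℕ∞) ≤ sExtGrade S p.asIdeal M) :
    (n : ℕ∞) ≤ depth (Localization.AtPrime p.asIdeal) (localizedAt M p) := by
  obtain ⟨xs, rfl, hmem, hxs⟩ := (forall_prop_ext_iff_exists_isWeakSeq S p.asIdeal M n).mp
    fun i hi => by
      by_contra hS
      have : (n : ℕ∞) ≤ i := h.trans (iInf₂_le i hS)
      exact absurd (by exact_mod_cast this) (not_le.mpr hi)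
  exact hxs.length_le_depth hp hmem

variable {S} in
/-- An `Ext` grade above `dim M_p` would give a regular sequence on `M_p` longer than `dim M_p`. -/
theorem sExtGrade_le_ht {p : PrimeSpectrum R} (hp : p ∈ sSupp S M) :
    (sExtGrade S p.asIdeal M : WithBot ℕ∞) ≤ ht M p := by
  obtain ⟨h, hh⟩ := exists_ht_eq hp.1
  by_contra! hlt
  rw [hh] at hlt
  have h1 : (h : ℕ∞) < sExtGrade S p.asIdeal M := WithBot.coe_lt_coe.mp hlt
  have h2 := le_depth_of_le_sExtGrade hp (n := h + 1)
    (by rw [Nat.cast_add, Nat.cast_one]; exact Order.add_one_le_of_lt h1)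
  have h3 := (WithBot.coe_le_coe.mpr h2).trans (depth_localizedAt_le_ht hp.1)
  rw [hh] at h3
  have h4 : h + 1 ≤ h := by exact_mod_cast h3
  omega

variable {S} in
theorem IsWeakSeq.length_le_sExtGrade {a : Ideal R} {xs : List R} (h : IsWeakSeq S M xs)
    (hmem : ∀ x ∈ xs, x ∈ a) : (xs.length : ℕ∞) ≤ sExtGrade S a M := by
  refine le_iInf₂ fun i hi => ?_
  by_contra! hlt
  exact hi ((forall_prop_ext_iff_exists_isWeakSeq S a M xs.length).mpr ⟨xs, rfl, hmem, h⟩ i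
    (by exact_mod_cast hlt))

variable [IsLocalRing R]

omit [S.IsSerreClass] [Module.Finite R M] in
theorem exists_dim_quotient_eq (p : PrimeSpectrum R) :
    ∃ c : ℕ, ringKrullDim (R ⧸ p.asIdeal) = c := by
  rw [← Module.supportDim_quotient_eq_ringKrullDim]
  exact exists_supportDim_eq (R := R) (R ⧸ p.asIdeal)

variable {S}

omit [S.IsSerreClass] in
/-- On an `S`-Cohen–Macaulay module, part of a system of parameters of length `dim M - dim R/p`
chosen inside `p` is a weak sequence with respect to `S`. -/
theorem IsSCohenMacaulay.exists_isWeakSeq (h : IsSCohenMacaulay S M) {p : PrimeSpectrum R}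
    [Nontrivial M] {r : ℕ} (hr : ringKrullDim (R ⧸ p.asIdeal) + r ≤ Module.supportDim R M) :
    ∃ xs : List R, xs.length = r ∧ (∀ x ∈ xs, x ∈ p.asIdeal) ∧ IsWeakSeq S M xs := by
  obtain ⟨xs, hlen, hmem, hxs⟩ := exists_isParamSeq M r hr
  obtain ⟨ys, hys, hlen'⟩ := hxs.exists_append
  exact ⟨xs, hlen, hmem, (h _ (isSystemOfParameters_iff.mpr ⟨hys, hlen'⟩)).of_append S⟩

omit [Module.Finite R M] in
/-- Numerical data at a prime `p` of the support: `dim M`, `dim M_p`, `dim R/p`, as naturals. -/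
theorem exists_dims {p : PrimeSpectrum R} (hp : p ∈ Module.support R M) :
    ∃ d h c : ℕ, Module.supportDim R M = d ∧ ht M p = h ∧ ringKrullDim (R ⧸ p.asIdeal) = c ∧
      h + c ≤ d := by
  have : Nontrivial M := Module.nonempty_support_iff.mp ⟨p, hp⟩
  obtain ⟨d, hd⟩ := exists_supportDim_eq (R := R) M
  obtain ⟨h, hh⟩ := exists_ht_eq hp
  obtain ⟨c, hc⟩ := exists_dim_quotient_eq p
  have := ht_add_dim_le hp
  rw [hd, hh, hc] at this
  exact ⟨d, h, c, hd, hh, hc, by exact_mod_cast this⟩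

/-- For an `S`-Cohen–Macaulay module all terms of `dim M - dim R/p ≤ depth M_p ≤ dim M_p ≤
dim M - dim R/p` agree, and a weak sequence of this length lies in `p`. -/
theorem IsSCohenMacaulay.exists_isWeakSeq_length_eq_ht (hM : IsSCohenMacaulay S M)
    {p : PrimeSpectrum R} (hp : p ∈ sSupp S M) :
    ht M p + ringKrullDim (R ⧸ p.asIdeal) = Module.supportDim R M ∧
      ∃ xs : List R, (xs.length : WithBot ℕ∞) = ht M p ∧ (∀ x ∈ xs, x ∈ p.asIdeal) ∧
        IsWeakSeq S M xs := by
  have : Nontrivial M := Module.nonempty_support_iff.mp ⟨p, hp.1⟩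
  obtain ⟨d, h, c, hd, hh, hc, hle⟩ := exists_dims hp.1
  obtain ⟨xs, hlen, hmem, hxs⟩ := hM.exists_isWeakSeq (p := p) (r := d - c) (by
    rw [hc, hd]
    exact_mod_cast (by omega : c + (d - c) ≤ d))
  have h1 := (WithBot.coe_le_coe.mpr (hxs.length_le_depth hp hmem)).trans
    (depth_localizedAt_le_ht hp.1)
  rw [hh, hlen] at h1
  have h2 : d - c ≤ h := by exact_mod_cast h1
  rw [hh, hc, hd]
  exact ⟨by exact_mod_cast (by omega : h + c = d), xs, by
    rw [hlen]; exact_mod_cast (by omega : d - c = h), hmem, hxs⟩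

/-- Let `p` be an associated prime of the quotient of `M` by part of a system of parameters. If `M_p` is
Cohen–Macaulay and `dim M_p + dim R/p = dim M`, then this part becomes a full system of
parameters of `M_p`, by unmixedness. -/
theorem length_eq_ht_of_mem_associatedPrimes {xs : List R} (hxs : IsParamSeq M xs)
    {p : PrimeSpectrum R} (hp : p.asIdeal ∈ associatedPrimes R (M ⧸ seqSMul M xs))
    (hCM : IsCohenMacaulay (Localization.AtPrime p.asIdeal) (localizedAt M p))
    (hdim : ht M p + ringKrullDim (R ⧸ p.asIdeal) = Module.supportDim R M) :
    (xs.length : WithBot ℕ∞) = ht M p := by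
  have hpN : p ∈ Module.support R (M ⧸ seqSMul M xs) := mem_support_of_mem_associatedPrimes hp
  have hpM : p ∈ Module.support R M :=
    Module.support_subset_of_surjective _ (Submodule.mkQ_surjective _) hpN
  have hnt := nontrivial_localizedAt hpM
  obtain ⟨d, h, c, hd, hh, hc, hle⟩ := exists_dims hpM
  obtain ⟨e, h', c', he, hh', hc', hle'⟩ := exists_dims hpN
  obtain rfl : c = c' := by
    have := hc.symm.trans hc'
    exact_mod_cast this
  have hmem : ∀ x ∈ xs, x ∈ p.asIdeal := fun x hx => by
    refine (Module.mem_support_iff_of_finite.mp hpN) (Module.mem_annihilator.mpr fun m => ?_)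
    obtain ⟨m, rfl⟩ := Submodule.Quotient.mk_surjective _ m
    rw [← Submodule.Quotient.mk_smul, Submodule.Quotient.mk_eq_zero]
    exact Submodule.smul_mem_smul (Ideal.subset_span hx) trivial
  let ys := xs.map (algebraMap R (Localization.AtPrime p.asIdeal))
  have hys : ∀ y ∈ ys, y ∈ maximalIdeal (Localization.AtPrime p.asIdeal) := fun y hy => by
    obtain ⟨x, hx, rfl⟩ := List.mem_map.mp hy
    exact (IsLocalization.AtPrime.to_map_mem_maximal_iff _ p.asIdeal x).mpr (hmem x hx)
  obtain ⟨f, hf⟩ : ∃ f : (M ⧸ seqSMul M xs) →ₗ[R] (localizedAt M p ⧸ seqSMul (localizedAt M p) ys),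
      IsLocalizedModule p.asIdeal.primeCompl f := by
    have := exists_isLocalizedModule_quotient (M := M) p (Ideal.ofList xs)
    rwa [Ideal.map_ofList] at this
  have hquot : Module.supportDim (Localization.AtPrime p.asIdeal)
      (localizedAt M p ⧸ seqSMul (localizedAt M p) ys) = h' := by
    rw [← hh']
    exact Module.supportDim_eq_of_equiv ((IsLocalizedModule.linearEquiv p.asIdeal.primeCompl f
      (LocalizedModule.mkLinearMap p.asIdeal.primeCompl
        (M ⧸ seqSMul M xs))).extendScalarsOfIsLocalization p.asIdeal.primeCompl _)
  have hlen : ys.length = xs.length := List.length_map _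
  have hde : e + xs.length = d := by
    have := hxs.2
    rw [he, hd] at this
    exact_mod_cast this
  have hhc : h + c = d := by
    rw [hh, hc, hd] at hdim
    exact_mod_cast hdim
  -- Dividing by `xs` lowers `dim M_p` by at most its length, and `dim (M / xs M)_p + dim R/p` is at
  -- most `dim M / xs M`, so `xs` remains part of a system of parameters over `R_p`.
  have hh'_le : h ≤ h' + xs.length := by
    have := supportDim_le_add_length (localizedAt M p) hys
    rw [hquot, show Module.supportDim _ (localizedAt M p) = h from hh, hlen] at this
    exact_mod_cast this
  have hparam : IsParamSeq (localizedAt M p) ys := by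
    refine ⟨hys, ?_⟩
    rw [hquot, show Module.supportDim _ (localizedAt M p) = h from hh, hlen]
    exact_mod_cast (by omega : h' + xs.length = h)
  have hreg : HasRegularSeq (R := Localization.AtPrime p.asIdeal) (localizedAt M p) h := by
    rw [← natCast_le_depth_iff]
    have h1 := hCM.resolve_left (not_subsingleton _)
    rw [show Module.supportDim _ (localizedAt M p) = h from hh] at h1
    exact WithBot.coe_le_coe.mp h1.ge
  obtain ⟨-, k, hk, zs, hzlen, hzmem, hz⟩ := hreg.of_isParamSeq hh hparam
  have hass : (closedPoint (Localization.AtPrime p.asIdeal)).asIdeal ∈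
      associatedPrimes (Localization.AtPrime p.asIdeal)
        (localizedAt M p ⧸ seqSMul (localizedAt M p) ys) := by
    refine Module.associatedPrimes.mem_associatedPrimes_of_comap_mem_associatedPrimes_of_isLocalizedModule
      p.asIdeal.primeCompl f _ ?_
    have : (closedPoint (Localization.AtPrime p.asIdeal)).asIdeal.comap
        (algebraMap R (Localization.AtPrime p.asIdeal)) = p.asIdeal :=
      Localization.AtPrime.under_maximalIdeal
    rwa [this]
  -- The maximal ideal is associated to the Cohen–Macaulay module `(M / xs M)_p`, so its dimension
  -- `k` is zero.
  have h0 := length_le_dim_quotient_associatedPrime hzmem hz hass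
  rw [dim_quotient_closedPoint, hzlen] at h0
  have hk0 : k ≤ 0 := by exact_mod_cast h0
  rw [hh]
  exact_mod_cast (by omega : xs.length = h)

/-- With respect to zero modules, `S`-Cohen–Macaulayness follows from Cohen–Macaulayness. -/
theorem isSCohenMacaulay_zeroClass [Nontrivial M] (h : IsCohenMacaulay R M) :
    IsSCohenMacaulay (zeroClass R) M := by
  intro xs hxs
  obtain ⟨n, hn⟩ := exists_supportDim_eq (R := R) M
  have h1 := h.resolve_left (not_subsingleton _)
  rw [hn] at h1
  have hreg := (natCast_le_depth_iff n).mp (WithBot.coe_le_coe.mp h1.ge)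
  exact (isWeakSeq_zeroClass_iff xs).mpr
    (hreg.of_isParamSeq hn (isSystemOfParameters_iff.mp hxs).1).1

omit [IsLocalRing R] in
/-- The dimension formula of a Cohen–Macaulay localization `M_p`. -/
theorem htQuot_add_ht_of_isCohenMacaulay {p q : PrimeSpectrum R}
    (hCM : IsCohenMacaulay (Localization.AtPrime p.asIdeal) (localizedAt M p))
    (hq : q ∈ Module.support R M) (hqp : q ≤ p) :
    (htQuot p q : WithBot ℕ∞) + ht M q = ht M p := by
  have := nontrivial_localizedAt (Module.mem_support_mono hqp hq)
  obtain ⟨Q, rfl⟩ := (range_specLocalization p).ge hqp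
  have hQ : Q ∈ sSupp (zeroClass (Localization.AtPrime p.asIdeal)) (localizedAt M p) :=
    ⟨(mem_support_localizedAt_iff M p Q).mpr hq, not_zeroClass_quotient Q⟩
  have h := ((isSCohenMacaulay_zeroClass hCM).exists_isWeakSeq_length_eq_ht hQ).1
  rw [ht_localization, dim_quotient_localization, ← htQuot_eq_krullDim_Icc hqp, add_comm] at h
  exact h

omit [IsNoetherianRing R] [Module.Finite R M] in
theorem ht_closedPoint : ht M (closedPoint R) = Module.supportDim R M := by
  rw [ht_eq_krullDim, Module.supportDim]
  refine krullDim_congr_set (Set.inter_eq_left.mpr fun q _ => ?_)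
  exact IsLocalRing.le_maximalIdeal q.2.ne_top

omit [IsNoetherianRing R] in
theorem htQuot_closedPoint (q : PrimeSpectrum R) :
    (htQuot (closedPoint R) q : WithBot ℕ∞) = ringKrullDim (R ⧸ q.asIdeal) := by
  have hle : ∀ q : PrimeSpectrum R, q ≤ closedPoint R := fun q =>
    IsLocalRing.le_maximalIdeal q.2.ne_top
  rw [htQuot_eq_krullDim_Icc (hle q), ringKrullDim_quotient_eq_krullDim_Ici]
  exact krullDim_congr_set (by ext r; simp [hle r])

/-- If `xᵢ₊₁` lay in an `S`-associated prime `q` of `M / (x₁, …, xᵢ) M`, then `q` would be in the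
support of `M / (x₁, …, xᵢ₊₁) M`, of dimension `dim M - i - 1 < dim R/q`. -/
theorem isSCohenMacaulay_of_dim_quotient
    (h : ∀ xs : List R, IsSystemOfParameters M xs → ∀ i ≤ xs.length,
      ∀ p ∈ sAss S (M ⧸ seqSMul M (xs.take i)),
        ringKrullDim (R ⧸ p.asIdeal) + (i : WithBot ℕ∞) = Module.supportDim R M) :
    IsSCohenMacaulay S M := by
  intro xs hxs
  rw [isWeakSeq_iff]
  intro i hi q hq hxq
  have hdim := h xs hxs i hi.le q hq
  have hqN := mem_support_of_mem_associatedPrimes hq.1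
  have hparam := (isSystemOfParameters_iff.mp hxs).1.take (i + 1)
  have hq' : q ∈ Module.support R (M ⧸ seqSMul M (xs.take (i + 1))) := by
    rw [seqSMul, Module.support_quotient] at hqN ⊢
    refine ⟨hqN.1, ?_⟩
    rw [← List.take_concat_get' xs i hi, Ideal.ofList_append]
    have h1 : Ideal.ofList (xs.take i) ≤ q.asIdeal := hqN.2
    have h2 : Ideal.ofList [xs[i]] ≤ q.asIdeal := by
      rw [Ideal.ofList_singleton]
      exact (Ideal.span_singleton_le_iff_mem _).mpr hxq
    exact sup_le h1 h2
  have h1 := dim_quotient_le_supportDim hq'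
  obtain ⟨d, -, c, hd, -, hc, -⟩ := exists_dims
    (Module.support_subset_of_surjective _ (Submodule.mkQ_surjective _) hqN)
  obtain ⟨e, -, -, he, -⟩ := exists_dims hq'
  have h2 := hparam.2
  rw [he, hd, List.length_take_of_le (by omega)] at h2
  rw [hc, he] at h1
  rw [hc, hd] at hdim
  have h1 : c ≤ e := by exact_mod_cast h1
  have h2 : e + (i + 1) = d := by exact_mod_cast h2
  have hdim : c + i = d := by exact_mod_cast hdim
  omega

end Conditions

end SerreCM

theorem theorem3p5 {R : Type u} [CommRing R] [IsNoetherianRing R] [IsLocalRing R]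
    (S : CategoryTheory.ObjectProperty (ModuleCat.{u} R)) [S.IsSerreClass]
    (M : Type u) [AddCommGroup M] [Module R M] [Module.Finite R M] :
    List.TFAE [
      SerreCM.IsSCohenMacaulay S M,
      ∀ p ∈ SerreCM.sSupp S M,
        SerreCM.IsCohenMacaulay (Localization.AtPrime p.asIdeal) (SerreCM.localizedAt M p) ∧
        SerreCM.ht M p + ringKrullDim (R ⧸ p.asIdeal) = Module.supportDim R M,
      ∀ p ∈ SerreCM.sSupp S M,
        (SerreCM.sExtGrade S p.asIdeal M : WithBot ℕ∞) = SerreCM.sHt S M p.asIdeal ∧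
        SerreCM.sHt S M p.asIdeal = SerreCM.ht M p ∧
        SerreCM.ht M p + ringKrullDim (R ⧸ p.asIdeal) = Module.supportDim R M,
      ∀ p ∈ SerreCM.sSupp S M,
        (SerreCM.depth (Localization.AtPrime p.asIdeal) (SerreCM.localizedAt M p) : WithBot ℕ∞)
          + ringKrullDim (R ⧸ p.asIdeal) = Module.supportDim R M,
      ∀ xs : List R, SerreCM.IsSystemOfParameters M xs → ∀ i ≤ xs.length,
        ∀ p ∈ SerreCM.sAss S (M ⧸ SerreCM.seqSMul M (xs.take i)),
          ringKrullDim (R ⧸ p.asIdeal) + (i : WithBot ℕ∞) = Module.supportDim R M,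
      (∀ p ∈ SerreCM.sSupp S M ∪ {IsLocalRing.closedPoint R},
        ∀ q ∈ SerreCM.sSupp S M ∪ {IsLocalRing.closedPoint R}, q.asIdeal ≤ p.asIdeal →
          (SerreCM.htQuot p q : WithBot ℕ∞) + SerreCM.ht M q = SerreCM.ht M p) ∧
      (∀ p ∈ SerreCM.sSupp S M,
        SerreCM.IsCohenMacaulay (Localization.AtPrime p.asIdeal) (SerreCM.localizedAt M p)) ∧
      (∀ p, Minimal (· ∈ SerreCM.sSupp S M) p →
        ringKrullDim (R ⧸ p.asIdeal) = Module.supportDim R M)] := by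
  tfae_have 1 → 3 := by
    intro h p hp
    obtain ⟨hdim, xs, hlen, hmem, hxs⟩ := h.exists_isWeakSeq_length_eq_ht hp
    refine ⟨?_, SerreCM.sHt_eq_ht S hp, hdim⟩
    rw [SerreCM.sHt_eq_ht S hp]
    refine le_antisymm (SerreCM.sExtGrade_le_ht hp) ?_
    rw [← hlen]
    exact WithBot.coe_le_coe.mpr (hxs.length_le_sExtGrade hmem)
  tfae_have 3 → 4 := by
    intro h p hp
    obtain ⟨h1, h2, h3⟩ := h p hp
    obtain ⟨n, hn⟩ := SerreCM.exists_ht_eq hp.1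
    rw [h2, hn] at h1
    have h4 := SerreCM.le_depth_of_le_sExtGrade hp (n := n) (WithBot.coe_le_coe.mp h1.ge)
    rw [← h3]
    congr 1
    exact le_antisymm (SerreCM.depth_localizedAt_le_ht hp.1) (hn ▸ WithBot.coe_le_coe.mpr h4)
  tfae_have 4 → 2 := by
    intro h p hp
    obtain ⟨c, hc⟩ := SerreCM.exists_dim_quotient_eq p
    have h1 := h p hp
    have h2 := SerreCM.depth_localizedAt_le_ht hp.1
    have h3 : SerreCM.ht M p =
        SerreCM.depth (Localization.AtPrime p.asIdeal) (SerreCM.localizedAt M p) := by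
      refine le_antisymm ?_ h2
      refine (ENat.WithBot.add_le_add_natCast_right_iff (c := c)).mp ?_
      rw [← hc, h1]
      exact SerreCM.ht_add_dim_le hp.1
    exact ⟨Or.inr h3.symm, by rw [h3, h1]⟩
  tfae_have 2 → 5 := by
    intro h xs hxs i hi p hp
    have hparam := (SerreCM.isSystemOfParameters_iff.mp hxs).1.take i
    have hpM : p ∈ SerreCM.sSupp S M := ⟨Module.support_subset_of_surjective _
      (Submodule.mkQ_surjective _) (SerreCM.mem_support_of_mem_associatedPrimes hp.1), hp.2⟩
    obtain ⟨h1, h2⟩ := h p hpM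
    have h3 := SerreCM.length_eq_ht_of_mem_associatedPrimes hparam hp.1 h1 h2
    rw [List.length_take_of_le hi] at h3
    rw [h3, add_comm, h2]
  tfae_have 5 → 1 := SerreCM.isSCohenMacaulay_of_dim_quotient
  tfae_have 2 → 6 := by
    intro h
    refine ⟨?_, fun p hp => (h p hp).1, fun p hp => ?_⟩
    · rintro p (hp | rfl) q hq hqp
      · -- If `q` is the maximal ideal, then so is `p`; thus `q` is in `S-Supp M` in any case.
        have hq : q ∈ SerreCM.sSupp S M := by
          rcases hq with hq | rfl
          · exact hq
          · rwa [show IsLocalRing.closedPoint R = p from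
              le_antisymm hqp (IsLocalRing.le_maximalIdeal p.2.ne_top)]
        exact SerreCM.htQuot_add_ht_of_isCohenMacaulay (h p hp).1 hq.1 hqp
      · rw [SerreCM.htQuot_closedPoint, SerreCM.ht_closedPoint]
        rcases hq with hq | rfl
        · rw [add_comm, (h q hq).2]
        · rw [SerreCM.dim_quotient_closedPoint, SerreCM.ht_closedPoint, zero_add]
    · -- A minimal element of `S-Supp M` is minimal in `Supp M`, so it has height zero on `M`.
      have h0 : SerreCM.ht M p = 0 := by
        rw [SerreCM.ht_eq_height hp.1.1]
        have : Order.height (⟨p, hp.1.1⟩ : Module.support R M) = 0 := by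
          rw [Order.height_eq_zero]
          rintro ⟨q, hq⟩ hqp
          exact hp.2 ⟨hq, fun hS => hp.1.2 (SerreCM.prop_quotient_of_le S hqp hS)⟩ hqp
        rw [this]
        rfl
      have := (h p hp.1).2
      rwa [h0, zero_add] at this
  tfae_have 6 → 2 := by
    rintro ⟨h1, h2, -⟩ p hp
    refine ⟨h2 p hp, ?_⟩
    -- The height formula for `p ⊆ 𝔪`, where `ht (𝔪/p) = dim R/p` and `ht_M 𝔪 = dim M`.
    have h4 := h1 (IsLocalRing.closedPoint R) (Or.inr rfl) p (Or.inl hp)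
      (IsLocalRing.le_maximalIdeal p.2.ne_top)
    rw [SerreCM.htQuot_closedPoint, SerreCM.ht_closedPoint] at h4
    rw [add_comm, h4]
  tfae_finish
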